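/- Let $\lambda>0$ be known, and let $F$ be a probability distribution on $\mathbb{R}$ with density $f$ and characteristic function $\phi_f(t)=\int e^{ity}f(y)\,dy$. Let $X_1,X_2,\dots$ be i.i.d. random variables of the form $X_i=Y_i+Z_i$, where $Y_i$ and $Z_i$ are independent, $Z_i$ is standard normal, and $Y_i$ is distributed as $\sum_{j=1}^{N}W_j$ with $N$ Poisson distributed with parameter $\lambda$ and independent of the i.i.d. variables $W_1,W_2,\dots$ with distribution $F$ (an empty sum is $0$). Let $h=h_n>0$ be bandwidths with $h_n\sim(\log n)^{-\beta}$ (that is, the ratio tends to $1$) for some $\beta<1/2$, let $M_n=C\log n$ for a constant $C>0$, and let $\phi_{emp}(t)=\frac1n\sum_{j=1}^n e^{itX_j}$ be the empirical characteristic function. Let $\phi_w=1_{[-1,1]}$, the Fourier transform of the sinc kernel $w(x)=\sin x/(\pi x)$. Put $$f_{nh}(x)=\frac{1}{2\pi\lambda}\int_{-1/h}^{1/h}e^{-itx}\operatorname{Log}\left(\frac{\phi_{emp}(t)\phi_w(ht)}{e^{-\lambda}e^{-t^2/2}}\right)dt ,\qquad \hat f_{nh}(x)=(M_n\wedge f_{nh}(x))\vee(-M_n),$$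 where $\operatorname{Log}$ is the distinguished logarithm, i.e. the continuous function $L$ on $[-1/h,1/h]$ such that $e^{L}$ equals the argument and $L(0)=\lambda$; if no such function exists, $f_{nh}(x)$ is set to $0$. Assume that $\phi_f$ is integrable and that $\int|y|^{\rho}f(y)\,dy<\infty$ for some $\rho>1$. Let $x\in\mathbb{R}$ be a point at which $f$ is continuous (as $\phi_f$ is integrable, $f$ has a continuous version, for which every $x$ is admissible). Then $\hat f_{nh}(x)$ is integrable for every $n$, and the following hold. (i) If $\phi_f(t)=O(e^{-|t|^{\alpha}})$ as $|t|\to\infty$ for some $1<\alpha\le 2$, then $$\operatorname{E}[\hat f_{nh}(x)]-f(x)=O\left(h^{\alpha-1}e^{-1/h^{\alpha}}\right)\quad\text{as } n\to\infty .$$ (ii) If $\phi_f(t)=O(|t|^{-\gamma})$ as $|t|\to\infty$ for some $\gamma>1$, then $$\operatorname{E}[\hat f_{nh}(x)]-f(x)=O\left(h^{\gamma-1}\right)\quad\text{as } n\to\infty .$$ -/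

import Mathlib

open MeasureTheory ProbabilityTheory Filter Asymptotics
open scoped NNReal

namespace Decompounding

noncomputable section

/-- The law of a Poisson sum `∑_{j=1}^{N} W_j`, where `N` is Poisson with parameter `lam`, the `W_j`
are i.i.d. with law `F`, and `N` is independent of `(W_j)`. -/
def compoundPoisson (lam : ℝ≥0) (F : Measure ℝ) [IsProbabilityMeasure F] : Measure ℝ :=
  ((poissonMeasure lam).prod (Measure.infinitePi fun _ : ℕ => F)).map
    fun p => ∑ j ∈ Finset.range p.1, p.2 j

/-- The map whose law is `compoundPoisson` is measurable, so that `Measure.map` is meaningful. -/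
theorem measurable_randomSum :
    Measurable fun p : ℕ × (ℕ → ℝ) => ∑ j ∈ Finset.range p.1, p.2 j :=
  measurable_from_prod_countable_right fun k => by
    change Measurable fun w : ℕ → ℝ => ∑ j ∈ Finset.range k, w j
    fun_prop

/-- The sinc kernel `w(x) = sin x / (π x)`, with `w(0) = 1 / π`. -/
def sincKernel (x : ℝ) : ℝ := Real.sinc x / Real.pi

/-- The Fourier transform `φ_w = 1_{[-1,1]}` of the sinc kernel. -/
def sincKernelFT (t : ℝ) : ℝ := (Set.Icc (-1 : ℝ) 1).indicator (fun _ => 1) t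

/-- The empirical characteristic function of a sample of size `n`. -/
def empCharFun {n : ℕ} (xs : Fin n → ℝ) (t : ℝ) : ℂ :=
  (1 / (n : ℂ)) * ∑ j, Complex.exp (Complex.I * t * xs j)

/-- `L` is a distinguished logarithm of `g` on `s`: a continuous logarithm on `s`, whose value at `0`
is the principal one (this is the real logarithm when `g 0 > 0`). -/
def IsDistinguishedLog (g L : ℝ → ℂ) (s : Set ℝ) : Prop :=
  ContinuousOn L s ∧ (∀ t ∈ s, Complex.exp (L t) = g t) ∧ L 0 = Complex.log (g 0)

open Classical in
/-- The distinguished logarithm of `g` on `s`; by convention it is `0` if there is none. -/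
def distinguishedLog (g : ℝ → ℂ) (s : Set ℝ) : ℝ → ℂ :=
  if H : ∃ L, IsDistinguishedLog g L s then H.choose else 0

/-- The distinguished logarithm is unique on an interval that contains `0`. -/
theorem IsDistinguishedLog.eqOn {g L₁ L₂ : ℝ → ℂ} {s : Set ℝ} (hs : IsPreconnected s)
    (h0 : (0 : ℝ) ∈ s) (h₁ : IsDistinguishedLog g L₁ s) (h₂ : IsDistinguishedLog g L₂ s) :
    Set.EqOn L₁ L₂ s :=
  Complex.isCoveringMap_exp.eqOn_of_comp_eqOn hs h₁.1 h₂.1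
    (fun t ht => Subtype.ext ((h₁.2.1 t ht).trans (h₂.2.1 t ht).symm)) h0
    (h₁.2.2.trans h₂.2.2.symm)

/-- `φ_emp(t) φ_w(ht) / (e^{-lam} e^{-t²/2})`, the estimator of `exp (lam φ_f(t))`. -/
def plugInRatio (lam h : ℝ) {n : ℕ} (xs : Fin n → ℝ) (t : ℝ) : ℂ :=
  empCharFun xs t * (sincKernelFT (h * t) : ℂ) /
    (Complex.exp (-(lam : ℂ)) * Complex.exp (-(t : ℂ) ^ 2 / 2))

/-- `(2π lam)⁻¹ ∫_{-1/h}^{1/h} e^{-itx} Log (φ_emp(t) φ_w(ht) / (e^{-lam} e^{-t²/2})) dt`, as a complex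
number; it is `0` if the distinguished logarithm on `[-1/h, 1/h]` does not exist. -/
def fnhComplex (lam h : ℝ) {n : ℕ} (xs : Fin n → ℝ) (x : ℝ) : ℂ :=
  1 / (2 * Real.pi * lam) * ∫ t in (-(1 / h))..(1 / h), Complex.exp (-Complex.I * t * x) *
    distinguishedLog (plugInRatio lam h xs) (Set.Icc (-(1 / h)) (1 / h)) t

/-- The plug-in estimator `f_{nh}(x)`. Taking the real part changes nothing, see `fnhComplex_im`. -/
def fnh (lam h : ℝ) {n : ℕ} (xs : Fin n → ℝ) (x : ℝ) : ℝ := (fnhComplex lam h xs x).re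

/-- The truncated estimator `(M ∧ f_{nh}(x)) ∨ (-M)`. -/
def fHat (lam h M : ℝ) {n : ℕ} (xs : Fin n → ℝ) (x : ℝ) : ℝ := max (min M (fnh lam h xs x)) (-M)

/-- `φ_w` is the Fourier transform of `w` (which is not integrable) in the sense of inversion. -/
theorem sincKernel_eq (x : ℝ) :
    (sincKernel x : ℂ) =
      1 / (2 * Real.pi) * ∫ t : ℝ, Complex.exp (-Complex.I * t * x) * (sincKernelFT t : ℂ) := by
  have h1 : (∫ t : ℝ, Complex.exp (-Complex.I * t * x) * (sincKernelFT t : ℂ)) =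
      ∫ t in (-1 : ℝ)..1, Complex.exp (-Complex.I * t * x) := by
    rw [intervalIntegral.integral_of_le (by norm_num), ← integral_Icc_eq_integral_Ioc,
      ← integral_indicator measurableSet_Icc]
    congr 1 with t
    by_cases ht : t ∈ Set.Icc (-1 : ℝ) 1
    · simp only [sincKernelFT, Set.indicator_of_mem ht]; simp
    · simp only [sincKernelFT, Set.indicator_of_notMem ht]; simp
  rw [h1]
  have hpi : (Real.pi : ℂ) ≠ 0 := by exact_mod_cast Real.pi_ne_zero
  by_cases hx : x = 0
  · subst hx
    simp [sincKernel]
    field_simp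
    norm_num
  · have h2 := integral_exp_mul_I_eq_sinc x
    have h3 : (∫ t in (-1 : ℝ)..1, Complex.exp (-Complex.I * t * x)) =
        (x : ℂ)⁻¹ * ∫ t in (-x)..x, Complex.exp (t * Complex.I) := by
      have := intervalIntegral.integral_comp_mul_left (a := -1) (b := 1)
        (fun t : ℝ => Complex.exp (t * Complex.I)) (c := -x) (by simpa using hx)
      have e : (∫ t in (-1 : ℝ)..1, Complex.exp (-Complex.I * t * x)) =
          ∫ t in (-1 : ℝ)..1, Complex.exp (((-x * t : ℝ) : ℂ) * Complex.I) := by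
        congr 1 with t
        congr 1
        push_cast
        ring
      rw [e, this, intervalIntegral.integral_symm]
      simp [Complex.real_smul]
    rw [h3, h2, sincKernel]
    have : (x : ℂ) ≠ 0 := by exact_mod_cast hx
    push_cast
    field_simp

/-- By Hermitian symmetry of the distinguished logarithm the estimator is real. -/
theorem fnhComplex_im (lam h : ℝ) (hh : 0 < h) {n : ℕ} (xs : Fin n → ℝ) (x : ℝ) :
    (fnhComplex lam h xs x).im = 0 := by
  set T := 1 / h with hT
  have hT0 : 0 < T := by positivity
  set g := plugInRatio lam h xs with hg
  set L := distinguishedLog g (Set.Icc (-T) T) with hL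
  have hgs : ∀ t, (starRingEnd ℂ) (g (-t)) = g t := by
    intro t
    have hw : sincKernelFT (h * -t) = sincKernelFT (h * t) := by
      unfold sincKernelFT Set.indicator
      have : h * -t ∈ Set.Icc (-1 : ℝ) 1 ↔ h * t ∈ Set.Icc (-1 : ℝ) 1 := by
        simp only [Set.mem_Icc]
        constructor <;> intro ⟨a, b⟩ <;> constructor <;> linarith
      simp only [this]
    simp only [hg, plugInRatio, empCharFun, hw, map_div₀, map_mul, map_sum, ← Complex.exp_conj]
    simp [map_ofNat]
  have hLs : ∀ t ∈ Set.Icc (-T) T, (starRingEnd ℂ) (L (-t)) = L t := by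
    by_cases H : ∃ L, IsDistinguishedLog g L (Set.Icc (-T) T)
    · have hspec : IsDistinguishedLog g L (Set.Icc (-T) T) := by
        rw [hL, distinguishedLog, dif_pos H]
        exact H.choose_spec
      have hneg : Set.MapsTo (fun t : ℝ => -t) (Set.Icc (-T) T) (Set.Icc (-T) T) := by
        intro t ht
        simp only [Set.mem_Icc] at ht ⊢
        constructor <;> linarith [ht.1, ht.2]
      refine IsDistinguishedLog.eqOn (L₁ := fun t => (starRingEnd ℂ) (L (-t)))
        isPreconnected_Icc (by simp [hT0.le]) ⟨?_, ?_, ?_⟩ hspec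
      · exact Complex.continuous_conj.comp_continuousOn
          (hspec.1.comp continuous_neg.continuousOn hneg)
      · intro t ht
        simp only [Complex.exp_conj]
        rw [hspec.2.1 _ (hneg ht), hgs]
      · have hr : g 0 = (Real.exp lam : ℂ) ∨ g 0 = 0 := by
          rcases Nat.eq_zero_or_pos n with rfl | hn
          · right
            simp [hg, plugInRatio, empCharFun]
          · left
            have : (n : ℂ) ≠ 0 := by exact_mod_cast hn.ne'
            simp [hg, plugInRatio, empCharFun, sincKernelFT, Complex.exp_neg, this]
        have h0 : L 0 = Complex.log (g 0) := hspec.2.2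
        simp only [neg_zero, h0]
        rcases hr with hr | hr
        · rw [hr, ← Complex.ofReal_log (Real.exp_pos _).le, Complex.conj_ofReal]
        · simp [hr]
    · intro t _
      simp [hL, distinguishedLog, dif_neg H]
  rw [← Complex.conj_eq_iff_im]
  unfold fnhComplex
  rw [map_mul]
  congr 1
  · simp [map_ofNat]
  rw [← intervalIntegral.intervalIntegral_conj]
  change ∫ t in (-T)..T, (starRingEnd ℂ) (Complex.exp (-Complex.I * t * x) * L t) =
    ∫ t in (-T)..T, Complex.exp (-Complex.I * t * x) * L t
  have hsub := intervalIntegral.integral_comp_neg (a := -T) (b := T)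
    fun t : ℝ => (starRingEnd ℂ) (Complex.exp (-Complex.I * t * x) * L t)
  rw [neg_neg] at hsub
  rw [← hsub]
  refine intervalIntegral.integral_congr fun t ht => ?_
  rw [Set.uIcc_of_le (by linarith)] at ht
  have := hLs t ht
  simp only [map_mul, ← Complex.exp_conj, this]
  simp

end

end Decompounding

/-! The characteristic function of an observation is `exp (lam φ)` times `e^{-lam} e^{-t²/2}`, with
`φ` that of the jumps. Replacing it by the empirical one and dividing estimates `exp (lam φ)`, whose
distinguished logarithm is `lam φ`. Write `T = 1 / h`, and let `D` be the truncated inversion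
integral of `lam φ` over `[-T, T]`. The bias splits into a deterministic part `D - f x` and a
stochastic part `E[fHat] - D`.

By Fourier inversion, `D - f x` is at most the tail integral of `|φ|` beyond `T`
(`norm_truncatedInversion_sub_density_le`). This alone gives the rates claimed.

The stochastic part is `O(n^{-1/16})`. An L² bound and a Lipschitz bound show that, off an event of
small probability, the empirical characteristic function is within `n^{-1/8}` of the true one on all
of `[-T, T]` (`exists_measurableSet_norm_empCharFun_sub_le`). Division by the Gaussian factor costs
`e^{T²/2}`, which is a small power of `n` because `β < 1/2` makes `T² = o(log n)`. The relative
error is then small, so the distinguished logarithm exists and is close to `lam φ`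
(`abs_fnh_sub_re_truncatedInversion_le`). On the bad event the truncation caps the error at `2 M_n`,
which is logarithmic in `n`.

Both target rates dominate `n^{-1/16}`, again because `T` and `T²` are `o(log n)`; for the
exponential rate this uses `α ≤ 2`. -/

namespace Decompounding

/-! ### Stability of the distinguished logarithm and of the truncated inversion integral -/

/-- A relative perturbation of size `δ ≤ 1 / 2` moves the distinguished logarithm by at most
`3 / 2 * δ`. -/
theorem IsDistinguishedLog.exists_of_norm_sub_le {g g' L : ℝ → ℂ} {s : Set ℝ} {δ : ℝ}
    (hL : IsDistinguishedLog g L s) (hg' : ContinuousOn g' s) (h0 : g' 0 = g 0) (hδ : δ ≤ 1 / 2)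
    (hclose : ∀ t ∈ s, ‖g' t - g t‖ ≤ δ * ‖g t‖) :
    ∃ L', IsDistinguishedLog g' L' s ∧ ∀ t ∈ s, ‖L' t - L t‖ ≤ 3 / 2 * δ := by
  have hg : ContinuousOn g s :=
    (Complex.continuous_exp.comp_continuousOn hL.1).congr fun t ht => (hL.2.1 t ht).symm
  have hne : ∀ t ∈ s, g t ≠ 0 := fun t ht => by
    rw [← hL.2.1 t ht]
    exact Complex.exp_ne_zero _
  have hz : ∀ t ∈ s, ‖(g' t - g t) / g t‖ ≤ δ := fun t ht => by
    rw [norm_div, div_le_iff₀ (norm_pos_iff.2 (hne t ht))]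
    exact hclose t ht
  have hslit : ∀ t ∈ s, 1 + (g' t - g t) / g t ∈ Complex.slitPlane := fun t ht =>
    Complex.mem_slitPlane_of_norm_lt_one (by linarith [hz t ht])
  -- The new logarithm is `L + log (g' / g)` with the principal branch, which is continuous here
  -- because `g' / g` stays within `1 / 2` of `1`.
  refine ⟨fun t => L t + Complex.log (1 + (g' t - g t) / g t), ⟨?_, fun t ht => ?_, ?_⟩,
    fun t ht => ?_⟩
  · exact hL.1.add (ContinuousOn.clog
      (continuousOn_const.add ((hg'.sub hg).div hg hne)) hslit)
  · rw [Complex.exp_add, hL.2.1 t ht, Complex.exp_log (Complex.slitPlane_ne_zero (hslit t ht))]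
    have := hne t ht
    field_simp
    ring
  · simp [h0, hL.2.2]
  · rw [add_sub_cancel_left]
    exact (Complex.norm_log_one_add_half_le_self ((hz t ht).trans hδ)).trans
      (by linarith [hz t ht])

theorem isDistinguishedLog_distinguishedLog {g : ℝ → ℂ} {s : Set ℝ}
    (H : ∃ L, IsDistinguishedLog g L s) : IsDistinguishedLog g (distinguishedLog g s) s := by
  rw [distinguishedLog, dif_pos H]
  exact H.choose_spec

/-- Uniqueness on a connected set transfers the bound from some logarithm of `g'` to the chosen one.
The first conclusion rules out the default value `0`. -/
theorem IsDistinguishedLog.norm_distinguishedLog_sub_le {g g' L : ℝ → ℂ} {s : Set ℝ} {δ : ℝ}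
    (hL : IsDistinguishedLog g L s) (hs : IsPreconnected s) (hs0 : (0 : ℝ) ∈ s)
    (hg' : ContinuousOn g' s) (h0 : g' 0 = g 0) (hδ : δ ≤ 1 / 2)
    (hclose : ∀ t ∈ s, ‖g' t - g t‖ ≤ δ * ‖g t‖) :
    IsDistinguishedLog g' (distinguishedLog g' s) s ∧
      ∀ t ∈ s, ‖distinguishedLog g' s t - L t‖ ≤ 3 / 2 * δ := by
  obtain ⟨L', hL', hb⟩ := hL.exists_of_norm_sub_le hg' h0 hδ hclose
  have hd := isDistinguishedLog_distinguishedLog ⟨L', hL'⟩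
  refine ⟨hd, fun t ht => ?_⟩
  rw [hd.eqOn hs hs0 hL' ht]
  exact hb t ht

/-- `(2π lam)⁻¹ ∫_{-T}^{T} e^{-itx} L(t) dt`. -/
noncomputable def truncatedInversion (lam T : ℝ) (L : ℝ → ℂ) (x : ℝ) : ℂ :=
  1 / (2 * Real.pi * lam) * ∫ t in (-T)..T, Complex.exp (-Complex.I * t * x) * L t

theorem norm_exp_neg_I_mul (t x : ℝ) : ‖Complex.exp (-Complex.I * t * x)‖ = 1 := by
  rw [show -Complex.I * t * x = ((-(t * x) : ℝ) : ℂ) * Complex.I by push_cast; ring]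
  exact Complex.norm_exp_ofReal_mul_I _

theorem norm_truncatedInversion_sub_le {lam T c : ℝ} (hlam : 0 < lam) (hT : 0 ≤ T)
    {L L' : ℝ → ℂ} (hL : ContinuousOn L (Set.Icc (-T) T)) (hL' : ContinuousOn L' (Set.Icc (-T) T))
    (hc : ∀ t ∈ Set.Icc (-T) T, ‖L' t - L t‖ ≤ c) (x : ℝ) :
    ‖truncatedInversion lam T L' x - truncatedInversion lam T L x‖ ≤ T / (Real.pi * lam) * c := by
  have hint : ∀ K : ℝ → ℂ, ContinuousOn K (Set.Icc (-T) T) →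
      IntervalIntegrable (fun t : ℝ => Complex.exp (-Complex.I * t * x) * K t) volume (-T) T := by
    intro K hK
    refine ContinuousOn.intervalIntegrable ?_
    rw [Set.uIcc_of_le (by linarith)]
    exact (Continuous.continuousOn (by fun_prop)).mul hK
  unfold truncatedInversion
  rw [← mul_sub, ← intervalIntegral.integral_sub (hint _ hL') (hint _ hL), norm_mul]
  have h1 : ‖∫ t in (-T)..T, (Complex.exp (-Complex.I * t * x) * L' t -
      Complex.exp (-Complex.I * t * x) * L t)‖ ≤ c * |T - -T| := by
    refine intervalIntegral.norm_integral_le_of_norm_le_const fun t ht => ?_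
    rw [Set.uIoc_of_le (by linarith)] at ht
    rw [← mul_sub, norm_mul, norm_exp_neg_I_mul, one_mul]
    exact hc t ⟨ht.1.le, ht.2⟩
  have h2 : ‖(1 / (2 * Real.pi * lam) : ℂ)‖ = 1 / (2 * Real.pi * lam) := by
    rw [show (1 / (2 * Real.pi * lam) : ℂ) = ((1 / (2 * Real.pi * lam) : ℝ) : ℂ) by push_cast; ring]
    rw [Complex.norm_real, Real.norm_of_nonneg]
    have := Real.pi_pos
    positivity
  rw [h2]
  rw [show |T - -T| = 2 * T by rw [abs_of_nonneg] <;> linarith] at h1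
  have hp := Real.pi_pos
  calc _ ≤ 1 / (2 * Real.pi * lam) * (c * (2 * T)) := by gcongr
    _ = _ := by field_simp

/-! ### The plug-in ratio and measurability of the estimator -/

theorem fnhComplex_eq_truncatedInversion (lam h : ℝ) {n : ℕ} (xs : Fin n → ℝ) (x : ℝ) :
    fnhComplex lam h xs x = truncatedInversion lam (1 / h)
      (distinguishedLog (plugInRatio lam h xs) (Set.Icc (-(1 / h)) (1 / h))) x := rfl

theorem sincKernelFT_mul_eq_one {h t : ℝ} (hh : 0 < h) (ht : t ∈ Set.Icc (-(1 / h)) (1 / h)) :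
    sincKernelFT (h * t) = 1 := by
  have h1 : h * (1 / h) = 1 := by field_simp
  refine Set.indicator_of_mem (s := Set.Icc (-1 : ℝ) 1) ⟨?_, ?_⟩ _
  · nlinarith [mul_le_mul_of_nonneg_left ht.1 hh.le]
  · nlinarith [mul_le_mul_of_nonneg_left ht.2 hh.le]

theorem plugInRatio_eq {lam h t : ℝ} (hh : 0 < h) (ht : t ∈ Set.Icc (-(1 / h)) (1 / h)) {n : ℕ}
    (xs : Fin n → ℝ) :
    plugInRatio lam h xs t =
      empCharFun xs t / (Complex.exp (-(lam : ℂ)) * Complex.exp (-(t : ℂ) ^ 2 / 2)) := by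
  simp [plugInRatio, sincKernelFT_mul_eq_one hh ht]

theorem continuous_empCharFun_uncurry (n : ℕ) :
    Continuous fun p : (Fin n → ℝ) × ℝ => empCharFun p.1 p.2 := by
  unfold empCharFun
  fun_prop

theorem continuousOn_plugInRatio (lam : ℝ) {h : ℝ} (hh : 0 < h) {n : ℕ} (xs : Fin n → ℝ) :
    ContinuousOn (plugInRatio lam h xs) (Set.Icc (-(1 / h)) (1 / h)) := by
  refine ContinuousOn.congr (f := fun t : ℝ =>
    empCharFun xs t / (Complex.exp (-(lam : ℂ)) * Complex.exp (-(t : ℂ) ^ 2 / 2))) ?_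
    fun t ht => plugInRatio_eq hh ht xs
  refine ((continuous_empCharFun_uncurry n).comp (by fun_prop : Continuous fun t : ℝ =>
    (xs, t))).continuousOn.div (Continuous.continuousOn (by fun_prop)) fun t _ => ?_
  exact mul_ne_zero (Complex.exp_ne_zero _) (Complex.exp_ne_zero _)

theorem zero_mem_Icc_neg_one_div {h : ℝ} (hh : 0 < h) : (0 : ℝ) ∈ Set.Icc (-(1 / h)) (1 / h) := by
  have : 0 < 1 / h := by positivity
  exact ⟨by linarith, this.le⟩

/-- The value at `0` is the same for all samples, which is the normalization that the perturbation
bound requires. For `n = 0` the empty mean would give `0` instead. -/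
theorem plugInRatio_zero {lam h : ℝ} (hh : 0 < h) {n : ℕ} (hn : n ≠ 0) (xs : Fin n → ℝ) :
    plugInRatio lam h xs 0 = Complex.exp lam := by
  have : (n : ℂ) ≠ 0 := by exact_mod_cast hn
  rw [plugInRatio_eq hh (zero_mem_Icc_neg_one_div hh)]
  simp [empCharFun, this, Complex.exp_neg]

/-- Nearby samples have uniformly close plug-in ratios, in the relative sense. -/
theorem eventually_norm_plugInRatio_sub_le {lam h : ℝ} (hh : 0 < h) {n : ℕ} {xs : Fin n → ℝ}
    (hne : ∀ t ∈ Set.Icc (-(1 / h)) (1 / h), plugInRatio lam h xs t ≠ 0) {δ : ℝ} (hδ : 0 < δ) :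
    ∀ᶠ xs' in nhds xs, ∀ t ∈ Set.Icc (-(1 / h)) (1 / h),
      ‖plugInRatio lam h xs' t - plugInRatio lam h xs t‖ ≤ δ * ‖plugInRatio lam h xs t‖ := by
  have key : ∀ᶠ xs' in nhds xs, ∀ t ∈ Set.Icc (-(1 / h)) (1 / h),
      ‖empCharFun xs' t - empCharFun xs t‖ < δ * ‖empCharFun xs t‖ := by
    -- Compactness of the interval reduces uniformity in `t` to a strict inequality between jointly
    -- continuous functions, which holds at `(xs, t)` because the ratio does not vanish there.
    refine IsCompact.eventually_forall_of_forall_eventually isCompact_Icc fun t ht => ?_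
    have hc := continuous_empCharFun_uncurry n
    have hc2 : Continuous fun p : (Fin n → ℝ) × ℝ => empCharFun xs p.2 :=
      hc.comp (by fun_prop : Continuous fun p : (Fin n → ℝ) × ℝ => (xs, p.2))
    have hopen := isOpen_lt (hc.sub hc2).norm (hc2.norm.const_mul δ)
    refine hopen.mem_nhds ?_
    have h1 : empCharFun xs t ≠ 0 := fun h0 => hne t ht (by
      rw [plugInRatio_eq hh ht, h0, zero_div])
    simpa using mul_pos hδ (norm_pos_iff.2 h1)
  filter_upwards [key] with xs' hxs' t ht
  rw [plugInRatio_eq hh ht, plugInRatio_eq hh ht, ← sub_div, norm_div, norm_div, ← mul_div_assoc]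
  gcongr
  exact (hxs' t ht).le

theorem measurable_fnhComplex {lam h : ℝ} (hlam : 0 < lam) (hh : 0 < h) (n : ℕ) (x : ℝ) :
    Measurable fun xs : Fin n → ℝ => fnhComplex lam h xs x := by
  classical
  set s := Set.Icc (-(1 / h)) (1 / h) with hs
  set E : Set (Fin n → ℝ) := {xs | ∃ L, IsDistinguishedLog (plugInRatio lam h xs) L s} with hE
  rcases eq_or_ne n 0 with rfl | hn
  · exact measurable_of_finite _
  have hs0 : (0 : ℝ) ∈ s := zero_mem_Icc_neg_one_div hh
  have hT : 0 ≤ 1 / h := by positivity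
  have near : ∀ xs ∈ E, ∀ δ : ℝ, 0 < δ → δ ≤ 1 / 2 → ∀ᶠ xs' in nhds xs, xs' ∈ E ∧
      ‖fnhComplex lam h xs' x - fnhComplex lam h xs x‖
        ≤ 1 / h / (Real.pi * lam) * (3 / 2 * δ) := by
    intro xs hxs δ hδ hδ2
    have hd := isDistinguishedLog_distinguishedLog hxs
    filter_upwards [eventually_norm_plugInRatio_sub_le (lam := lam) hh (xs := xs)
      (fun t ht => by rw [← hd.2.1 t ht]; exact Complex.exp_ne_zero _) hδ] with xs' hxs'
    have := hd.norm_distinguishedLog_sub_le isPreconnected_Icc hs0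
      (continuousOn_plugInRatio lam hh xs')
      (by rw [plugInRatio_zero hh hn, plugInRatio_zero hh hn]) hδ2 hxs'
    refine ⟨⟨_, this.1⟩, ?_⟩
    rw [fnhComplex_eq_truncatedInversion, fnhComplex_eq_truncatedInversion]
    exact norm_truncatedInversion_sub_le hlam hT hd.1 this.1.1 this.2 x
  have hopen : IsOpen E := isOpen_iff_mem_nhds.2 fun xs hxs =>
    (near xs hxs (1 / 2) (by norm_num) le_rfl).mono fun _ h => h.1
  have hcont : ContinuousOn (fun xs : Fin n → ℝ => fnhComplex lam h xs x) E := by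
    intro xs hxs
    refine ContinuousAt.continuousWithinAt (Metric.tendsto_nhds.2 fun ε hε => ?_)
    have hp := Real.pi_pos
    set c := 1 / h / (Real.pi * lam) with hc
    have hc0 : 0 < c := by positivity
    -- The bound `1 / 2` keeps the logarithm under control; `ε / (3 * c)` makes the resulting error
    -- at most `ε / 2`.
    filter_upwards [near xs hxs (min (1 / 2) (ε / (3 * c))) (by positivity) (min_le_left _ _)]
      with xs' hxs'
    rw [dist_eq_norm]
    refine hxs'.2.trans_lt ?_
    calc c * (3 / 2 * min (1 / 2) (ε / (3 * c))) ≤ c * (3 / 2 * (ε / (3 * c))) := by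
          gcongr
          exact min_le_right _ _
      _ = ε / 2 := by field_simp
      _ < ε := by linarith
  have heq : (fun xs : Fin n → ℝ => fnhComplex lam h xs x) =
      E.piecewise (fun xs => fnhComplex lam h xs x) 0 := by
    ext1 xs
    by_cases hxs : xs ∈ E
    · rw [Set.piecewise_eq_of_mem _ _ _ hxs]
    · rw [Set.piecewise_eq_of_notMem _ _ _ hxs]
      have : distinguishedLog (plugInRatio lam h xs) s = 0 := dif_neg hxs
      rw [fnhComplex_eq_truncatedInversion, this]
      simp [truncatedInversion]
  rw [heq]
  exact hcont.measurable_piecewise continuousOn_const hopen.measurableSet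

theorem measurable_fHat {lam h : ℝ} (hlam : 0 < lam) (hh : 0 < h) (M : ℝ) (n : ℕ) (x : ℝ) :
    Measurable fun xs : Fin n → ℝ => fHat lam h M xs x := by
  have := Complex.measurable_re.comp (measurable_fnhComplex hlam hh n x)
  exact (measurable_const.min this).max measurable_const

theorem abs_fHat_le {lam h M : ℝ} (hM : 0 ≤ M) {n : ℕ} (xs : Fin n → ℝ) (x : ℝ) :
    |fHat lam h M xs x| ≤ M :=
  abs_le.2 ⟨le_max_right _ _, max_le (min_le_left _ _) (by linarith)⟩

/-! ### Characteristic function, first moment and product law of the observations -/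

theorem integral_exp_sum_infinitePi (F : Measure ℝ) [IsProbabilityMeasure F] (k : ℕ) (t : ℝ) :
    ∫ w : ℕ → ℝ, Complex.exp (t * ((∑ j ∈ Finset.range k, w j : ℝ) : ℂ) * Complex.I)
      ∂(Measure.infinitePi fun _ : ℕ => F) = charFun F t ^ k := by
  have hind : iIndepFun (fun (j : ℕ) (w : ℕ → ℝ) => w j) (Measure.infinitePi fun _ : ℕ => F) :=
    iIndepFun_infinitePi (X := fun _ y => y) fun _ => measurable_id
  have h1 := congrFun (iIndepFun.charFun_map_fun_finsetSum_eq_prod (s := Finset.range k)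
    (fun i _ => (measurable_pi_apply i).aemeasurable) (hind.restrict _)) t
  rw [charFun_apply_real, integral_map (by fun_prop) (by fun_prop)] at h1
  rw [h1]
  simp [Measure.infinitePi_map_eval]

/-- The characteristic function of a compound Poisson law is `exp (lam (φ - 1))`. -/
theorem charFun_compoundPoisson (lam : ℝ≥0) (F : Measure ℝ) [IsProbabilityMeasure F] (t : ℝ) :
    charFun (compoundPoisson lam F) t = Complex.exp (lam * (charFun F t - 1)) := by
  have hm := measurable_randomSum
  have hint : Integrable (fun p : ℕ × (ℕ → ℝ) =>
      Complex.exp (t * ((∑ j ∈ Finset.range p.1, p.2 j : ℝ) : ℂ) * Complex.I))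
      ((poissonMeasure lam).prod (Measure.infinitePi fun _ : ℕ => F)) := by
    refine Integrable.of_bound (C := 1) ?_ (ae_of_all _ fun p => ?_)
    · exact (Complex.measurable_exp.comp (((Complex.measurable_ofReal.comp hm).const_mul
        (t : ℂ)).mul_const Complex.I)).aestronglyMeasurable
    · rw [← Complex.ofReal_mul, Complex.norm_exp_ofReal_mul_I]
  rw [charFun_apply_real, compoundPoisson, integral_map hm.aemeasurable (by fun_prop),
    integral_prod _ hint]
  simp only [integral_exp_sum_infinitePi]
  rw [integral_poissonMeasure]
  -- Averaging `φ ^ k` over the Poisson weights sums the exponential series of `lam * φ`.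
  have h1 := ((NormedSpace.expSeries_div_hasSum_exp ((lam : ℂ) * charFun F t)).mul_left
    (Complex.exp (-(lam : ℂ)))).tsum_eq
  rw [← Complex.exp_eq_exp_ℂ, ← Complex.exp_add] at h1
  rw [show (lam : ℂ) * (charFun F t - 1) = -lam + lam * charFun F t by ring, ← h1]
  congr 1 with k
  rw [Complex.real_smul]
  push_cast
  ring

theorem integrable_natCast_poissonMeasure (lam : ℝ≥0) :
    Integrable (fun k : ℕ => (k : ℝ)) (poissonMeasure lam) := by
  -- After an index shift the factor `k + 1` cancels against `(k + 1)!`.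
  rw [integrable_poissonMeasure_iff, ← summable_nat_add_iff 1]
  have h := (Real.summable_pow_div_factorial lam).mul_left (Real.exp (-lam) * lam)
  refine h.congr fun k => ?_
  have : ((k.factorial : ℕ) : ℝ) ≠ 0 := by positivity
  rw [Nat.factorial_succ, Real.norm_of_nonneg (by positivity)]
  push_cast
  field_simp
  ring

/-- A compound Poisson law has a first moment if the jump law does. -/
theorem integrable_id_compoundPoisson (lam : ℝ≥0) (F : Measure ℝ) [IsProbabilityMeasure F]
    (hF : Integrable (fun y : ℝ => y) F) :
    Integrable (fun y : ℝ => y) (compoundPoisson lam F) := by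
  have hm := measurable_randomSum
  rw [compoundPoisson, integrable_map_measure (by fun_prop) hm.aemeasurable]
  have hj : ∀ j : ℕ, Integrable (fun w : ℕ → ℝ => w j) (Measure.infinitePi fun _ : ℕ => F) :=
    fun j => (measurePreserving_eval_infinitePi (fun _ : ℕ => F) j).integrable_comp_of_integrable hF
  have hjn : ∀ j : ℕ, ∫ w : ℕ → ℝ, ‖w j‖ ∂(Measure.infinitePi fun _ : ℕ => F) = ∫ y, ‖y‖ ∂F := by
    intro j
    have := integral_map (μ := Measure.infinitePi fun _ : ℕ => F)
      (measurable_pi_apply j).aemeasurable (f := fun y : ℝ => ‖y‖) (by fun_prop)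
    rw [Measure.infinitePi_map_eval] at this
    exact this.symm
  refine (integrable_prod_iff hm.aestronglyMeasurable).2 ⟨ae_of_all _ fun k => ?_, ?_⟩
  · exact integrable_finsetSum (Finset.range k) fun j _ => hj j
  -- Given `N = k` the mean absolute sum is at most `k` times that of one jump, and `N` has a finite
  -- mean.
  · refine ((integrable_natCast_poissonMeasure lam).mul_const (∫ y, ‖y‖ ∂F)).mono'
      .of_discrete (ae_of_all _ fun k => ?_)
    rw [Real.norm_of_nonneg (integral_nonneg fun _ => norm_nonneg _)]
    calc ∫ w : ℕ → ℝ, ‖∑ j ∈ Finset.range k, w j‖ ∂(Measure.infinitePi fun _ : ℕ => F)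
        ≤ ∫ w : ℕ → ℝ, ∑ j ∈ Finset.range k, ‖w j‖ ∂(Measure.infinitePi fun _ : ℕ => F) :=
          integral_mono (integrable_finsetSum _ fun j _ => hj j).norm
            (integrable_finsetSum _ fun j _ => (hj j).norm) fun w => norm_sum_le _ _
      _ = k * ∫ y, ‖y‖ ∂F := by
          rw [integral_finsetSum _ fun j _ => (hj j).norm]
          simp only [hjn, Finset.sum_const, Finset.card_range, nsmul_eq_mul]

instance isProbabilityMeasure_compoundPoisson (lam : ℝ≥0) (F : Measure ℝ)
    [IsProbabilityMeasure F] : IsProbabilityMeasure (compoundPoisson lam F) :=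
  Measure.isProbabilityMeasure_map measurable_randomSum.aemeasurable

/-- The law of an observation: compound Poisson plus independent standard normal noise. -/
noncomputable def noisyCompoundPoisson (lam : ℝ≥0) (F : Measure ℝ) [IsProbabilityMeasure F] :
    Measure ℝ :=
  (compoundPoisson lam F) ∗ (gaussianReal 0 1)

instance isProbabilityMeasure_noisyCompoundPoisson (lam : ℝ≥0) (F : Measure ℝ)
    [IsProbabilityMeasure F] : IsProbabilityMeasure (noisyCompoundPoisson lam F) := by
  unfold noisyCompoundPoisson
  infer_instance

/-- The second factor is exactly the denominator of `plugInRatio`. -/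
theorem charFun_noisyCompoundPoisson (lam : ℝ≥0) (F : Measure ℝ) [IsProbabilityMeasure F] (t : ℝ) :
    charFun (noisyCompoundPoisson lam F) t =
      Complex.exp (lam * charFun F t) *
        (Complex.exp (-((lam : ℝ) : ℂ)) * Complex.exp (-(t : ℂ) ^ 2 / 2)) := by
  rw [noisyCompoundPoisson, charFun_conv, charFun_compoundPoisson, charFun_gaussianReal,
    ← Complex.exp_add, ← Complex.exp_add, ← Complex.exp_add]
  congr 1
  push_cast
  ring

theorem integrable_id_noisyCompoundPoisson (lam : ℝ≥0) (F : Measure ℝ) [IsProbabilityMeasure F]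
    (hF : Integrable (fun y : ℝ => y) F) :
    Integrable (fun y : ℝ => y) (noisyCompoundPoisson lam F) := by
  rw [noisyCompoundPoisson, Measure.conv, integrable_map_measure (by fun_prop) (by fun_prop)]
  have hg : Integrable (fun y : ℝ => y) (gaussianReal 0 1) :=
    (memLp_id_gaussianReal 1).integrable (by simp)
  exact ((integrable_id_compoundPoisson lam F hF).comp_fst _).add (hg.comp_snd _)

/-- The sample `(X_0, …, X_{n-1})` has the product law. -/
theorem map_sample_eq_pi {Ω : Type*} [MeasurableSpace Ω] {P : Measure Ω} [IsProbabilityMeasure P]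
    {lam : ℝ≥0} {F : Measure ℝ} [IsProbabilityMeasure F] {X Y Z : ℕ → Ω → ℝ}
    (hY : ∀ i, HasLaw (Y i) (compoundPoisson lam F) P)
    (hZ : ∀ i, HasLaw (Z i) (gaussianReal 0 1) P)
    (hYZ : ∀ i, IndepFun (Y i) (Z i) P)
    (hXYZ : ∀ i ω, X i ω = Y i ω + Z i ω) (hX : iIndepFun X P) (n : ℕ) :
    AEMeasurable (fun ω (j : Fin n) => X j ω) P ∧
      P.map (fun ω (j : Fin n) => X j ω) = Measure.pi fun _ => noisyCompoundPoisson lam F := by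
  have hXe : ∀ i, X i = Y i + Z i := fun i => funext fun ω => hXYZ i ω
  have hlaw : ∀ i, HasLaw (X i) (noisyCompoundPoisson lam F) P := fun i => by
    rw [hXe]
    exact (hYZ i).hasLaw_add (hY i) (hZ i)
  have hind : iIndepFun (fun j : Fin n => X j) P := hX.precomp Fin.val_injective
  refine ⟨aemeasurable_pi_lambda _ fun j => (hlaw j).aemeasurable, ?_⟩
  rw [(iIndepFun_iff_map_fun_eq_pi_map fun j : Fin n => (hlaw j).aemeasurable).1 hind]
  congr 1 with j
  rw [(hlaw j).map_eq]

/-! ### Mean square and uniform deviation of the empirical characteristic function -/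

/-- The mean square error of a sample mean of a function bounded by `1` is at most `1 / n`. -/
theorem integral_sq_sampleMean_sub_le (μ : Measure ℝ) [IsProbabilityMeasure μ] {n : ℕ} (hn : n ≠ 0)
    {u : ℝ → ℝ} (hu : Measurable u) (hu1 : ∀ y, |u y| ≤ 1) :
    ∫ xs : Fin n → ℝ, ((1 / (n : ℝ)) * ∑ j, u (xs j) - ∫ y, u y ∂μ) ^ 2
      ∂(Measure.pi fun _ => μ) ≤ 1 / (n : ℝ) := by
  set Q := Measure.pi fun _ : Fin n => μ with hQ
  have hn' : (n : ℝ) ≠ 0 := by exact_mod_cast hn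
  set U : Fin n → (Fin n → ℝ) → ℝ := fun j xs => u (xs j) with hU
  have hUm : ∀ j, Measurable (U j) := fun j => hu.comp (measurable_pi_apply j)
  have hLp : ∀ j, MemLp (U j) 2 Q := fun j =>
    MemLp.of_bound (hUm j).aestronglyMeasurable 1 (ae_of_all _ fun xs => hu1 _)
  have hind : iIndepFun U Q := iIndepFun_pi (X := fun _ => u) fun _ => hu.aemeasurable
  have hmean : ∀ j, ∫ xs, U j xs ∂Q = ∫ y, u y ∂μ := fun j => by
    have := integral_map (μ := Q) (measurable_pi_apply j).aemeasurable (f := u)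
      hu.aestronglyMeasurable
    rw [(measurePreserving_eval (fun _ : Fin n => μ) j).map_eq] at this
    exact this.symm
  have hvar : ∀ j, variance (U j) Q ≤ 1 := fun j => by
    refine (variance_le_expectation_sq (hUm j).aestronglyMeasurable).trans ?_
    have : ∫ xs, (U j ^ 2) xs ∂Q ≤ ∫ _, (1 : ℝ) ∂Q := by
      refine integral_mono (hLp j).integrable_sq (integrable_const _) fun xs => ?_
      exact (sq_le_one_iff_abs_le_one _).2 (hu1 _)
    simpa using this
  have hsum : variance (∑ j, U j) Q ≤ n := by
    rw [IndepFun.variance_sum (fun j _ => hLp j) fun i _ j _ hij => hind.indepFun hij]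
    calc ∑ j, variance (U j) Q ≤ ∑ _j : Fin n, (1 : ℝ) := Finset.sum_le_sum fun j _ => hvar j
      _ = n := by simp
  have hS : AEMeasurable (fun xs => (1 / (n : ℝ)) * (∑ j, U j) xs) Q := by
    refine Measurable.aemeasurable (Measurable.const_mul ?_ _)
    simpa only [Finset.sum_fn] using Finset.measurable_sum Finset.univ fun j _ => hUm j
  have h1 := variance_eq_integral hS
  rw [variance_const_mul] at h1
  have h2 : ∫ xs, (1 / (n : ℝ)) * (∑ j, U j) xs ∂Q = ∫ y, u y ∂μ := by
    rw [integral_const_mul]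
    simp only [Finset.sum_apply]
    rw [integral_finsetSum _ fun j _ => (hLp j).integrable (by norm_num)]
    simp only [hmean, Finset.sum_const, Finset.card_univ, Fintype.card_fin, nsmul_eq_mul]
    field_simp
  rw [h2] at h1
  simp only [Finset.sum_apply] at h1
  calc _ = (1 / (n : ℝ)) ^ 2 * variance (∑ j, U j) Q := h1.symm
    _ ≤ (1 / (n : ℝ)) ^ 2 * n := by gcongr
    _ = 1 / n := by field_simp

theorem integrable_exp_mul_I (μ : Measure ℝ) [IsProbabilityMeasure μ] (t : ℝ) :
    Integrable (fun y : ℝ => Complex.exp (t * y * Complex.I)) μ := by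
  refine Integrable.of_bound (C := 1) (Continuous.aestronglyMeasurable (by fun_prop))
    (ae_of_all _ fun y => ?_)
  rw [← Complex.ofReal_mul, Complex.norm_exp_ofReal_mul_I]

theorem re_charFun (μ : Measure ℝ) [IsProbabilityMeasure μ] (t : ℝ) :
    (charFun μ t).re = ∫ y, Real.cos (t * y) ∂μ := by
  rw [charFun_apply_real]
  have := integral_re (integrable_exp_mul_I μ t)
  simp only [RCLike.re_to_complex] at this
  rw [← this]
  congr 1 with y
  rw [← Complex.ofReal_mul, Complex.exp_ofReal_mul_I_re]

theorem im_charFun (μ : Measure ℝ) [IsProbabilityMeasure μ] (t : ℝ) :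
    (charFun μ t).im = ∫ y, Real.sin (t * y) ∂μ := by
  rw [charFun_apply_real]
  have := integral_im (integrable_exp_mul_I μ t)
  simp only [RCLike.im_to_complex] at this
  rw [← this]
  congr 1 with y
  rw [← Complex.ofReal_mul, Complex.exp_ofReal_mul_I_im]

theorem empCharFun_eq {n : ℕ} (xs : Fin n → ℝ) (t : ℝ) :
    empCharFun xs t = ((1 / (n : ℝ) : ℝ) : ℂ) * ∑ j, Complex.exp ((t * xs j : ℝ) * Complex.I) := by
  unfold empCharFun
  push_cast
  congr 1
  refine Finset.sum_congr rfl fun j _ => ?_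
  congr 1
  ring

theorem re_empCharFun {n : ℕ} (xs : Fin n → ℝ) (t : ℝ) :
    (empCharFun xs t).re = (1 / (n : ℝ)) * ∑ j, Real.cos (t * xs j) := by
  rw [empCharFun_eq, Complex.re_ofReal_mul, Complex.re_sum]
  simp only [Complex.exp_ofReal_mul_I_re]

theorem im_empCharFun {n : ℕ} (xs : Fin n → ℝ) (t : ℝ) :
    (empCharFun xs t).im = (1 / (n : ℝ)) * ∑ j, Real.sin (t * xs j) := by
  rw [empCharFun_eq, Complex.im_ofReal_mul, Complex.im_sum]
  simp only [Complex.exp_ofReal_mul_I_im]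

theorem norm_empCharFun_le_one {n : ℕ} (xs : Fin n → ℝ) (t : ℝ) : ‖empCharFun xs t‖ ≤ 1 := by
  rcases eq_or_ne n 0 with rfl | hn
  · simp [empCharFun]
  have hn' : (n : ℝ) ≠ 0 := by exact_mod_cast hn
  rw [empCharFun_eq, norm_mul, Complex.norm_real, Real.norm_of_nonneg (by positivity)]
  calc _ ≤ (1 / (n : ℝ)) * ∑ j, ‖Complex.exp ((t * xs j : ℝ) * Complex.I)‖ := by
        gcongr
        exact norm_sum_le _ _
    _ = 1 := by
        simp only [Complex.norm_exp_ofReal_mul_I]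
        simp [hn']

theorem continuous_empCharFun_sub (μ : Measure ℝ) [IsProbabilityMeasure μ] (n : ℕ) :
    Continuous fun p : (Fin n → ℝ) × ℝ => ‖empCharFun p.1 p.2 - charFun μ p.2‖ ^ 2 :=
  (((continuous_empCharFun_uncurry n).sub (continuous_charFun.comp continuous_snd)).norm).pow 2

theorem norm_empCharFun_sub_sq_le (μ : Measure ℝ) [IsProbabilityMeasure μ] {n : ℕ}
    (xs : Fin n → ℝ) (t : ℝ) : ‖empCharFun xs t - charFun μ t‖ ^ 2 ≤ 4 := by
  have h1 : ‖empCharFun xs t - charFun μ t‖ ≤ 2 := by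
    refine (norm_sub_le _ _).trans ?_
    linarith [norm_empCharFun_le_one xs t, norm_charFun_le_one (μ := μ) t]
  nlinarith [norm_nonneg (empCharFun xs t - charFun μ t)]

/-- Real and imaginary parts are sample means of a cosine and a sine, and each contributes `1 / n`.
-/
theorem integral_norm_empCharFun_sub_sq_le (μ : Measure ℝ) [IsProbabilityMeasure μ] {n : ℕ}
    (hn : n ≠ 0) (t : ℝ) :
    ∫ xs : Fin n → ℝ, ‖empCharFun xs t - charFun μ t‖ ^ 2 ∂(Measure.pi fun _ => μ) ≤ 2 / n := by
  have hc := integral_sq_sampleMean_sub_le μ hn (u := fun y => Real.cos (t * y)) (by fun_prop)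
    fun y => Real.abs_cos_le_one _
  have hs := integral_sq_sampleMean_sub_le μ hn (u := fun y => Real.sin (t * y)) (by fun_prop)
    fun y => Real.abs_sin_le_one _
  have hint : ∀ v : (Fin n → ℝ) → ℝ, Measurable v →
      (∀ xs, v xs ^ 2 ≤ ‖empCharFun xs t - charFun μ t‖ ^ 2) →
      Integrable (fun xs => v xs ^ 2) (Measure.pi fun _ : Fin n => μ) := fun v hv hv4 =>
    Integrable.of_bound (C := 4) (hv.pow_const 2).aestronglyMeasurable (ae_of_all _ fun xs => by
      rw [Real.norm_of_nonneg (sq_nonneg _)]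
      exact (hv4 xs).trans (norm_empCharFun_sub_sq_le μ xs t))
  have heq : ∀ xs : Fin n → ℝ, ‖empCharFun xs t - charFun μ t‖ ^ 2 =
      ((1 / (n : ℝ)) * ∑ j, Real.cos (t * xs j) - ∫ y, Real.cos (t * y) ∂μ) ^ 2 +
      ((1 / (n : ℝ)) * ∑ j, Real.sin (t * xs j) - ∫ y, Real.sin (t * y) ∂μ) ^ 2 := by
    intro xs
    rw [← re_charFun, ← im_charFun, ← re_empCharFun, ← im_empCharFun, ← Complex.sub_re,
      ← Complex.sub_im, ← Complex.normSq_eq_norm_sq, Complex.normSq_apply]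
    ring
  rw [integral_congr_ae (ae_of_all _ heq), integral_add]
  · calc _ ≤ 1 / (n : ℝ) + 1 / n := add_le_add hc hs
      _ = 2 / n := by ring
  · exact hint _ (by fun_prop) fun xs => by rw [heq]; exact le_add_of_nonneg_right (sq_nonneg _)
  · exact hint _ (by fun_prop) fun xs => by rw [heq]; exact le_add_of_nonneg_left (sq_nonneg _)

theorem integral_intervalIntegral_empCharFun_sub_sq_le (μ : Measure ℝ) [IsProbabilityMeasure μ]
    {n : ℕ} (hn : n ≠ 0) {S : ℝ} (hS : 0 ≤ S) :
    ∫ xs : Fin n → ℝ, (∫ t in (-S)..S, ‖empCharFun xs t - charFun μ t‖ ^ 2)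
      ∂(Measure.pi fun _ => μ) ≤ 4 * S / n := by
  set Q := Measure.pi fun _ : Fin n => μ with hQ
  simp only [intervalIntegral.integral_of_le (show -S ≤ S by linarith)]
  have hint : Integrable (Function.uncurry fun (xs : Fin n → ℝ) (t : ℝ) =>
      ‖empCharFun xs t - charFun μ t‖ ^ 2) (Q.prod (volume.restrict (Set.Ioc (-S) S))) := by
    refine Integrable.of_bound (C := 4) (continuous_empCharFun_sub μ n).aestronglyMeasurable
      (ae_of_all _ fun p => ?_)
    rw [Function.uncurry, Real.norm_of_nonneg (sq_nonneg _)]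
    exact norm_empCharFun_sub_sq_le μ p.1 p.2
  rw [integral_integral_swap hint]
  calc _ ≤ ∫ _t in Set.Ioc (-S) S, 2 / (n : ℝ) :=
        integral_mono hint.integral_prod_right (integrable_const _)
          fun t => integral_norm_empCharFun_sub_sq_le μ hn t
    _ = 4 * S / n := by
        rw [setIntegral_const]
        simp only [measureReal_def, Real.volume_Ioc, smul_eq_mul]
        rw [ENNReal.toReal_ofReal (by linarith)]
        ring

theorem norm_exp_mul_I_sub_le (a b : ℝ) :
    ‖Complex.exp (a * Complex.I) - Complex.exp (b * Complex.I)‖ ≤ |a - b| := by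
  have h1 : Complex.exp (a * Complex.I) - Complex.exp (b * Complex.I) =
      Complex.exp (b * Complex.I) * (Complex.exp (Complex.I * ((a - b : ℝ) : ℂ)) - 1) := by
    rw [mul_sub, ← Complex.exp_add, mul_one]
    congr 2
    push_cast
    ring
  rw [h1, norm_mul, Complex.norm_exp_ofReal_mul_I, one_mul]
  exact Real.norm_exp_I_mul_ofReal_sub_one_le

/-- The Lipschitz constant is random, the sample mean of `|X_j|`; a first moment of the observations
controls it through Markov's inequality. -/
theorem norm_empCharFun_sub_empCharFun_le {n : ℕ} (xs : Fin n → ℝ) (t s : ℝ) :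
    ‖empCharFun xs t - empCharFun xs s‖ ≤ (1 / (n : ℝ) * ∑ j, |xs j|) * |t - s| := by
  rw [empCharFun_eq, empCharFun_eq, ← mul_sub, norm_mul, Complex.norm_real,
    Real.norm_of_nonneg (by positivity), ← Finset.sum_sub_distrib, mul_assoc, Finset.sum_mul]
  gcongr
  refine (norm_sum_le _ _).trans (Finset.sum_le_sum fun j _ => ?_)
  refine (norm_exp_mul_I_sub_le _ _).trans_eq ?_
  rw [← sub_mul, abs_mul, mul_comm]

theorem norm_charFun_sub_charFun_le (μ : Measure ℝ) [IsProbabilityMeasure μ]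
    (hμ : Integrable (fun y : ℝ => y) μ) (t s : ℝ) :
    ‖charFun μ t - charFun μ s‖ ≤ (∫ y, |y| ∂μ) * |t - s| := by
  rw [charFun_apply_real, charFun_apply_real,
    ← integral_sub (integrable_exp_mul_I μ t) (integrable_exp_mul_I μ s), ← integral_mul_const]
  refine norm_integral_le_of_norm_le (hμ.abs.mul_const _) (ae_of_all _ fun y => ?_)
  rw [← Complex.ofReal_mul, ← Complex.ofReal_mul]
  refine (norm_exp_mul_I_sub_le _ _).trans_eq ?_
  rw [← sub_mul, abs_mul, mul_comm]

/-- A Lipschitz function with a small `L²` norm on a slightly larger interval is uniformly small. -/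
theorem norm_le_of_integral_sq_lt {G : ℝ → ℂ} {K T ε : ℝ} (hK : 0 < K) (hε : 0 < ε)
    (hεK : ε ≤ 2 * K) (hG : ∀ t s, ‖G t - G s‖ ≤ K * |t - s|)
    (hI : ∫ t in (-(T + 1))..(T + 1), ‖G t‖ ^ 2 < ε ^ 3 / (4 * K)) {t₀ : ℝ}
    (ht₀ : t₀ ∈ Set.Icc (-T) T) : ‖G t₀‖ ≤ ε := by
  by_contra! hlt
  have hcont : Continuous G := by
    refine (LipschitzWith.of_dist_le_mul (K := ⟨K, hK.le⟩) fun t s => ?_).continuous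
    rw [dist_eq_norm, Real.dist_eq]
    exact hG t s
  -- If `‖G t₀‖ > ε`, then `‖G‖ ≥ ε / 2` within distance `w` of `t₀`, which contributes `2 w (ε /
  -- 2)² = ε³ / (4 K)` to the integral. As `w ≤ 1`, the window stays inside `[-(T + 1), T + 1]`.
  set w := ε / (2 * K) with hw
  have hw0 : 0 < w := by positivity
  have hw1 : w ≤ 1 := (div_le_one (by positivity)).2 hεK
  have hint : ∀ a b : ℝ, IntervalIntegrable (fun t => ‖G t‖ ^ 2) volume a b := fun a b =>
    (hcont.norm.pow 2).intervalIntegrable _ _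
  have h1 : ∫ t in (t₀ - w)..(t₀ + w), ‖G t‖ ^ 2 ≤ ∫ t in (-(T + 1))..(T + 1), ‖G t‖ ^ 2 :=
    intervalIntegral.integral_mono_interval (by linarith [ht₀.1]) (by linarith)
      (by linarith [ht₀.2]) (ae_of_all _ fun t => sq_nonneg _) (hint _ _)
  have h2 : ∫ _t in (t₀ - w)..(t₀ + w), (ε / 2) ^ 2 ≤ ∫ t in (t₀ - w)..(t₀ + w), ‖G t‖ ^ 2 := by
    refine intervalIntegral.integral_mono_on (by linarith) (by simp) (hint _ _) fun t ht => ?_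
    have h3 : |t - t₀| ≤ w := abs_le.2 ⟨by linarith [ht.1], by linarith [ht.2]⟩
    have h4 : ‖G t - G t₀‖ ≤ ε / 2 := (hG t t₀).trans (by
      calc K * |t - t₀| ≤ K * w := by gcongr
        _ = ε / 2 := by rw [hw]; field_simp)
    have h5 : ε / 2 ≤ ‖G t‖ := by
      have := norm_sub_norm_le (G t₀) (G t)
      rw [norm_sub_rev] at this
      linarith
    gcongr
  rw [intervalIntegral.integral_const, smul_eq_mul] at h2
  have h6 : (t₀ + w - (t₀ - w)) * (ε / 2) ^ 2 = ε ^ 3 / (4 * K) := by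
    rw [hw]
    field_simp
    ring
  linarith

/-- With high probability the empirical characteristic function is uniformly close to the
characteristic function on `[-T, T]`. -/
theorem exists_measurableSet_norm_empCharFun_sub_le (μ : Measure ℝ) [IsProbabilityMeasure μ]
    (hμ : Integrable (fun y : ℝ => y) μ) {n : ℕ} (hn : n ≠ 0) {T ε K : ℝ} (hT : 0 ≤ T)
    (hε : 0 < ε) (hK : 0 < K) (hεK : ε ≤ 2 * K) :
    ∃ B : Set (Fin n → ℝ), MeasurableSet B ∧
      (Measure.pi fun _ : Fin n => μ).real B ≤ (∫ y, |y| ∂μ) / K +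
        16 * (T + 1) * (K + ∫ y, |y| ∂μ) / (n * ε ^ 3) ∧
      ∀ xs ∉ B, ∀ t ∈ Set.Icc (-T) T, ‖empCharFun xs t - charFun μ t‖ ≤ ε := by
  set Q := Measure.pi fun _ : Fin n => μ with hQ
  set m := ∫ y, |y| ∂μ with hm
  have hm0 : 0 ≤ m := integral_nonneg fun _ => abs_nonneg _
  have hn' : (0 : ℝ) < n := by exact_mod_cast Nat.pos_of_ne_zero hn
  set A : (Fin n → ℝ) → ℝ := fun xs => 1 / (n : ℝ) * ∑ j, |xs j| with hA
  set I : (Fin n → ℝ) → ℝ := fun xs =>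
    ∫ t in (-(T + 1))..(T + 1), ‖empCharFun xs t - charFun μ t‖ ^ 2 with hI
  have hAm : Measurable A := by fun_prop
  have hIm : Continuous I :=
    intervalIntegral.continuous_parametric_intervalIntegral_of_continuous'
      (continuous_empCharFun_sub μ n) _ _
  have hcoord : ∀ j : Fin n, Integrable (fun xs : Fin n → ℝ => |xs j|) Q := fun j =>
    (measurePreserving_eval (fun _ : Fin n => μ) j).integrable_comp_of_integrable hμ.abs
  have hAi : Integrable A Q := (integrable_finsetSum _ fun j _ => hcoord j).const_mul _
  have hAe : ∫ xs, A xs ∂Q = m := by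
    have : ∀ j : Fin n, ∫ xs : Fin n → ℝ, |xs j| ∂Q = m := fun j => by
      have := integral_map (μ := Q) (measurable_pi_apply j).aemeasurable
        (f := fun y : ℝ => |y|) (by fun_prop)
      rw [(measurePreserving_eval (fun _ : Fin n => μ) j).map_eq] at this
      exact this.symm
    rw [hA, integral_const_mul, integral_finsetSum _ fun j _ => hcoord j]
    simp only [this, Finset.sum_const, Finset.card_univ, Fintype.card_fin, nsmul_eq_mul]
    field_simp
  have hI0 : ∀ xs, 0 ≤ I xs := fun xs =>
    intervalIntegral.integral_nonneg (by linarith) fun t _ => sq_nonneg _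
  have hIi : Integrable I Q := by
    refine Integrable.of_bound (C := 4 * |T + 1 - -(T + 1)|) hIm.aestronglyMeasurable
      (ae_of_all _ fun xs => ?_)
    refine intervalIntegral.norm_integral_le_of_norm_le_const fun t _ => ?_
    rw [Real.norm_of_nonneg (sq_nonneg _)]
    exact norm_empCharFun_sub_sq_le μ xs t
  set η := ε ^ 3 / (4 * (K + m)) with hη
  have hη0 : 0 < η := by positivity
  have markov : ∀ (V : (Fin n → ℝ) → ℝ), (∀ xs, 0 ≤ V xs) → Integrable V Q → ∀ c > 0,
      Q.real {xs | c ≤ V xs} ≤ (∫ xs, V xs ∂Q) / c := fun V hV hVi c hc => by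
    rw [le_div_iff₀ hc, mul_comm]
    exact mul_meas_ge_le_integral_of_nonneg (ae_of_all _ hV) hVi c
  -- The bad samples have a large empirical Lipschitz constant or a large L² deviation, and Markov's
  -- inequality bounds both. Off them the deviation is Lipschitz with constant `K + m`, for which
  -- `η` is the threshold.
  refine ⟨{xs | K ≤ A xs} ∪ {xs | η ≤ I xs}, (measurableSet_le measurable_const hAm).union
    (measurableSet_le measurable_const hIm.measurable), ?_, fun xs hxs t ht => ?_⟩
  · refine (measureReal_union_le _ _).trans (add_le_add ?_ ?_)
    · exact (markov A (fun xs => by positivity) hAi K hK).trans_eq (by rw [hAe])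
    · refine (markov I hI0 hIi η hη0).trans ?_
      calc (∫ xs, I xs ∂Q) / η ≤ (4 * (T + 1) / n) / η := by
            gcongr
            exact integral_intervalIntegral_empCharFun_sub_sq_le μ hn (by linarith)
        _ = _ := by
            rw [hη]
            have : K + m ≠ 0 := by positivity
            field_simp
            ring
  · simp only [Set.mem_union, Set.mem_ofPred_eq, not_or, not_le] at hxs
    refine norm_le_of_integral_sq_lt (G := fun t => empCharFun xs t - charFun μ t) (K := K + m)
      (by positivity) hε (by linarith) (fun t s => ?_) hxs.2 ht
    rw [show empCharFun xs t - charFun μ t - (empCharFun xs s - charFun μ s) =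
      (empCharFun xs t - empCharFun xs s) - (charFun μ t - charFun μ s) by ring, add_mul]
    refine (norm_sub_le _ _).trans (add_le_add ?_ (norm_charFun_sub_charFun_le μ hμ t s))
    refine (norm_empCharFun_sub_empCharFun_le xs t s).trans ?_
    gcongr
    exact hxs.1.le

/-! ### From uniform deviations to the expectation of the truncated estimator -/

/-- The exponent `lam * φ` is itself continuous and is real at `0`, since `φ 0 = 1`, so it is the
distinguished branch. -/
theorem isDistinguishedLog_exp_charFun (lam : ℝ) (F : Measure ℝ) [IsProbabilityMeasure F]
    (s : Set ℝ) :
    IsDistinguishedLog (fun t => Complex.exp (lam * charFun F t)) (fun t => lam * charFun F t)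
      s := by
  refine ⟨(continuous_charFun.const_mul _).continuousOn, fun _ _ => rfl, ?_⟩
  simp only [charFun_zero, probReal_univ, Complex.ofReal_one, mul_one]
  rw [← Complex.ofReal_exp, ← Complex.ofReal_log (Real.exp_pos _).le, Real.log_exp]

/-- If the empirical characteristic function is uniformly close to the true one, then the estimator
is close to the truncated inversion integral of the jump characteristic function. -/
theorem abs_fnh_sub_re_truncatedInversion_le {lam : ℝ≥0} (hlam : 0 < lam) (F : Measure ℝ)
    [IsProbabilityMeasure F] {h : ℝ} (hh : 0 < h) {n : ℕ} (hn : n ≠ 0) {xs : Fin n → ℝ} {ε : ℝ}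
    (hgood : ∀ t ∈ Set.Icc (-(1 / h)) (1 / h),
      ‖empCharFun xs t - charFun (noisyCompoundPoisson lam F) t‖ ≤ ε)
    (hδ : ε * Real.exp (2 * lam + (1 / h) ^ 2 / 2) ≤ 1 / 2) (x : ℝ) :
    |fnh lam h xs x - (truncatedInversion lam (1 / h) (fun t => (lam : ℝ) * charFun F t) x).re| ≤
      1 / h / (Real.pi * lam) * (3 / 2 * (ε * Real.exp (2 * lam + (1 / h) ^ 2 / 2))) := by
  have hlam' : (0 : ℝ) < lam := hlam
  have h0 := zero_mem_Icc_neg_one_div hh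
  have hε : 0 ≤ ε := (norm_nonneg _).trans (hgood 0 h0)
  have hL := isDistinguishedLog_exp_charFun lam F (Set.Icc (-(1 / h)) (1 / h))
  have hclose : ∀ t ∈ Set.Icc (-(1 / h)) (1 / h),
      ‖plugInRatio lam h xs t - Complex.exp ((lam : ℝ) * charFun F t)‖ ≤
        ε * Real.exp (2 * lam + (1 / h) ^ 2 / 2) * ‖Complex.exp ((lam : ℝ) * charFun F t)‖ := by
    intro t ht
    set D := Complex.exp (-((lam : ℝ) : ℂ)) * Complex.exp (-(t : ℂ) ^ 2 / 2) with hD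
    have hD0 : D ≠ 0 := mul_ne_zero (Complex.exp_ne_zero _) (Complex.exp_ne_zero _)
    have hDn : ‖D‖ = Real.exp (-lam - t ^ 2 / 2) := by
      have : D = ((Real.exp (-lam - t ^ 2 / 2) : ℝ) : ℂ) := by
        rw [hD, ← Complex.exp_add, Complex.ofReal_exp]
        congr 1
        push_cast
        ring
      rw [this, Complex.norm_real, Real.norm_of_nonneg (Real.exp_pos _).le]
    have h1 : plugInRatio lam h xs t - Complex.exp ((lam : ℝ) * charFun F t) =
        (empCharFun xs t - charFun (noisyCompoundPoisson lam F) t) / D := by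
      rw [plugInRatio_eq hh ht, charFun_noisyCompoundPoisson, ← hD, sub_div,
        mul_div_cancel_right₀ _ hD0]
    -- As `|φ| ≤ 1`, the target is bounded away from `0`. This costs one factor `e^{lam}` in the
    -- relative error, and the denominator `D` costs another along with `e^{T²/2}`.
    have h2 : Real.exp (-lam) ≤ ‖Complex.exp ((lam : ℝ) * charFun F t)‖ := by
      rw [Complex.norm_exp, Real.exp_le_exp, Complex.re_ofReal_mul]
      have h3 := (abs_le.1 ((Complex.abs_re_le_norm _).trans (norm_charFun_le_one (μ := F) t))).1
      nlinarith
    have h4 : t ^ 2 ≤ (1 / h) ^ 2 := sq_le_sq' ht.1 ht.2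
    rw [h1, norm_div, hDn]
    calc _ ≤ ε / Real.exp (-lam - t ^ 2 / 2) := by gcongr; exact hgood t ht
      _ = ε * Real.exp (lam + t ^ 2 / 2) := by
          rw [div_eq_mul_inv, ← Real.exp_neg]
          congr 2
          ring
      _ ≤ ε * Real.exp (lam + (1 / h) ^ 2 / 2) := by gcongr
      _ = ε * Real.exp (2 * lam + (1 / h) ^ 2 / 2) * Real.exp (-lam) := by
          rw [mul_assoc, ← Real.exp_add]
          congr 2
          ring
      _ ≤ _ := by gcongr
  have hd := hL.norm_distinguishedLog_sub_le isPreconnected_Icc h0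
    (continuousOn_plugInRatio lam hh xs)
    (by rw [plugInRatio_zero hh hn]; simp) hδ hclose
  have key := norm_truncatedInversion_sub_le hlam' (one_div_pos.2 hh).le hL.1 hd.1.1 hd.2 x
  rw [fnh, fnhComplex_eq_truncatedInversion, ← Complex.sub_re]
  exact (Complex.abs_re_le_norm _).trans key

/-- Truncation is the projection onto `[-M, M]`, which brings a point no farther from any element of
that interval. -/
theorem abs_clamp_sub_le {M a b : ℝ} (hb : |b| ≤ M) : |max (min M a) (-M) - b| ≤ |a - b| := by
  obtain ⟨h1, h2⟩ := abs_le.1 hb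
  rcases le_total M a with h | h
  · rw [min_eq_left h, max_eq_left (by linarith), abs_of_nonneg (by linarith),
      abs_of_nonneg (by linarith)]
    linarith
  · rw [min_eq_right h]
    rcases le_total (-M) a with h' | h'
    · rw [max_eq_left h']
    · rw [max_eq_right h', abs_of_nonpos (by linarith), abs_of_nonpos (by linarith)]
      linarith

/-- The expectation of the truncated estimator, when the estimator is within `δ` of the centering
`D` off a bad set of samples. -/
theorem abs_integral_fHat_sub_le {lam h M D δ : ℝ} (hlam : 0 < lam) (hh : 0 < h)
    (hD : |D| ≤ M) {n : ℕ} (Q : Measure (Fin n → ℝ)) [IsProbabilityMeasure Q]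
    {B : Set (Fin n → ℝ)} (hB : MeasurableSet B) {x : ℝ} (hδ0 : 0 ≤ δ)
    (hδ : ∀ xs ∉ B, |fnh lam h xs x - D| ≤ δ) :
    |(∫ xs, fHat lam h M xs x ∂Q) - D| ≤ δ + 2 * M * Q.real B := by
  have hM : 0 ≤ M := (abs_nonneg D).trans hD
  have hint : Integrable (fun xs => fHat lam h M xs x) Q :=
    Integrable.of_bound (C := M) (measurable_fHat hlam hh M n x).aestronglyMeasurable
      (ae_of_all _ fun xs => abs_fHat_le hM xs x)
  have h1 : (∫ xs, fHat lam h M xs x ∂Q) - D = ∫ xs, (fHat lam h M xs x - D) ∂Q := by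
    rw [integral_sub hint (integrable_const _)]
    simp
  have hi2 : Integrable (fun xs => δ + B.indicator (fun _ => 2 * M) xs) Q :=
    (integrable_const _).add ((integrable_const _).indicator hB)
  rw [h1, ← Real.norm_eq_abs]
  refine (norm_integral_le_of_norm_le hi2 (ae_of_all _ fun xs => ?_)).trans_eq ?_
  · rw [Real.norm_eq_abs]
    by_cases hxs : xs ∈ B
    · rw [Set.indicator_of_mem hxs]
      have := abs_sub (fHat lam h M xs x) D
      linarith [abs_fHat_le (lam := lam) (h := h) hM xs x]
    · rw [Set.indicator_of_notMem hxs, add_zero]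
      exact (abs_clamp_sub_le hD).trans (hδ xs hxs)
  · rw [integral_add (integrable_const _) ((integrable_const _).indicator hB),
      integral_indicator_const _ hB]
    simp [mul_comm]

/-! ### Fourier inversion of the jump density and the deterministic bias -/

theorem integrable_of_withDensity {F : Measure ℝ} [IsProbabilityMeasure F] {f : ℝ → ℝ}
    (hf_meas : Measurable f) (hf_nonneg : ∀ y, 0 ≤ f y)
    (hF : F = volume.withDensity fun y => ENNReal.ofReal (f y)) : Integrable f := by
  refine ⟨hf_meas.aestronglyMeasurable, ?_⟩
  rw [hasFiniteIntegral_iff_ofReal (ae_of_all _ hf_nonneg)]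
  have h1 : F Set.univ = 1 := measure_univ
  rw [hF, withDensity_apply _ MeasurableSet.univ, Measure.restrict_univ] at h1
  rw [h1]
  exact ENNReal.one_lt_top

theorem charFun_eq_integral_density {F : Measure ℝ} {f : ℝ → ℝ}
    (hf_meas : Measurable f) (hf_nonneg : ∀ y, 0 ≤ f y)
    (hF : F = volume.withDensity fun y => ENNReal.ofReal (f y)) (t : ℝ) :
    charFun F t = ∫ y : ℝ, Complex.exp (t * y * Complex.I) * (f y : ℂ) := by
  rw [charFun_apply_real, hF, integral_withDensity_eq_integral_toReal_smul (by fun_prop)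
    (ae_of_all _ fun _ => ENNReal.ofReal_lt_top)]
  congr 1 with y
  rw [ENNReal.toReal_ofReal (hf_nonneg y), Complex.real_smul, mul_comm]

/-- The first moment is all that is needed of the moment condition; it provides the Lipschitz bounds
on characteristic functions. -/
theorem integrable_id_of_integrable_rpow {F : Measure ℝ} [IsProbabilityMeasure F]
    {f : ℝ → ℝ} (hf_meas : Measurable f) (hf_nonneg : ∀ y, 0 ≤ f y)
    (hF : F = volume.withDensity fun y => ENNReal.ofReal (f y)) {ρ : ℝ} (hρ : 1 ≤ ρ)
    (hmom : Integrable fun y : ℝ => |y| ^ ρ * f y) : Integrable (fun y : ℝ => y) F := by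
  rw [hF, integrable_withDensity_iff_integrable_smul' (by fun_prop)
    (ae_of_all _ fun _ => ENNReal.ofReal_lt_top)]
  refine ((integrable_of_withDensity hf_meas hf_nonneg hF).add hmom).mono'
    (by fun_prop) (ae_of_all _ fun y => ?_)
  rw [ENNReal.toReal_ofReal (hf_nonneg y), smul_eq_mul, norm_mul, Real.norm_of_nonneg (hf_nonneg y),
    Real.norm_eq_abs]
  have h1 : |y| ≤ 1 + |y| ^ ρ := by
    rcases le_total |y| 1 with h | h
    · have := Real.rpow_nonneg (abs_nonneg y) ρ
      linarith
    · have := Real.rpow_le_rpow_of_exponent_le h hρ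
      rw [Real.rpow_one] at this
      linarith
  have := mul_le_mul_of_nonneg_left h1 (hf_nonneg y)
  simp only [Pi.add_apply]
  linarith

/-- Fourier inversion at a continuity point of the density. -/
theorem density_eq_integral_charFun {F : Measure ℝ} [IsProbabilityMeasure F]
    {f : ℝ → ℝ} (hf_meas : Measurable f) (hf_nonneg : ∀ y, 0 ≤ f y)
    (hF : F = volume.withDensity fun y => ENNReal.ofReal (f y)) (hφ : Integrable (charFun F))
    {x : ℝ} (hx : ContinuousAt f x) :
    (f x : ℂ) = 1 / (2 * Real.pi) * ∫ t : ℝ, Complex.exp (-Complex.I * t * x) * charFun F t := by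
  have hpi := Real.pi_pos
  set fc : ℝ → ℂ := fun y => (f y : ℂ) with hfc
  -- The Fourier kernel here is `e^{-2πi w y}`, so `t = -2π w`; undoing this substitution below
  -- produces the factor `1 / (2π)`.
  have hft : FourierTransform.fourier fc = fun w : ℝ => charFun F (-(2 * Real.pi) * w) := by
    ext w
    rw [Real.fourier_eq', charFun_eq_integral_density hf_meas hf_nonneg hF]
    congr 1 with y
    rw [smul_eq_mul]
    congr 2
    simp
    ring
  have hint : Integrable (FourierTransform.fourier fc) := by
    rw [hft]
    exact hφ.comp_mul_left' (neg_ne_zero.2 (by positivity))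
  have key := (integrable_of_withDensity hf_meas hf_nonneg hF).ofReal.fourierInv_fourier_eq hint
    (v := x) (Complex.continuous_ofReal.continuousAt.comp hx)
  rw [hft, Real.fourierInv_eq'] at key
  rw [show (f x : ℂ) = fc x from rfl, ← key]
  have hsub := Measure.integral_comp_mul_left
    (fun t : ℝ => Complex.exp (-Complex.I * t * x) * charFun F t) (-(2 * Real.pi))
  have habs : |(-(2 * Real.pi))⁻¹| = 1 / (2 * Real.pi) := by
    rw [abs_inv, abs_neg, abs_of_pos (by positivity), one_div]
  rw [habs, Complex.real_smul] at hsub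
  push_cast at hsub
  rw [← hsub]
  congr 1 with w
  rw [smul_eq_mul]
  congr 2
  simp
  ring

/-- Hermitian symmetry, `φ (-t)` being the conjugate of `φ t`, makes the two tails equal in norm. -/
theorem integral_Iic_norm_charFun (F : Measure ℝ) (T : ℝ) :
    ∫ t in Set.Iic (-T), ‖charFun F t‖ = ∫ t in Set.Ioi T, ‖charFun F t‖ := by
  rw [← integral_comp_neg_Ioi]
  simp

/-- The factor `lam` cancels, and inversion leaves the two tails over `2π`; their equal norms give
`1 / π ≤ 1` times one tail. -/
theorem norm_truncatedInversion_sub_density_le {F : Measure ℝ} [IsProbabilityMeasure F]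
    {f : ℝ → ℝ} (hf_meas : Measurable f) (hf_nonneg : ∀ y, 0 ≤ f y)
    (hF : F = volume.withDensity fun y => ENNReal.ofReal (f y)) (hφ : Integrable (charFun F))
    {x : ℝ} (hx : ContinuousAt f x) {lam T : ℝ} (hlam : lam ≠ 0) :
    ‖truncatedInversion lam T (fun t => lam * charFun F t) x - f x‖ ≤
      ∫ t in Set.Ioi T, ‖charFun F t‖ := by
  have hpi := Real.pi_pos
  set G : ℝ → ℂ := fun t => Complex.exp (-Complex.I * t * x) * charFun F t with hG
  have hGn : ∀ t, ‖G t‖ = ‖charFun F t‖ := fun t => by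
    rw [hG, norm_mul, norm_exp_neg_I_mul, one_mul]
  have hGi : Integrable G := by
    refine hφ.mono ?_ (ae_of_all _ fun t => (hGn t).le)
    exact (Continuous.aestronglyMeasurable (by fun_prop)).mul hφ.1
  have h1 : truncatedInversion lam T (fun t => lam * charFun F t) x =
      1 / (2 * Real.pi) * ∫ t in (-T)..T, G t := by
    have : ∀ t : ℝ, Complex.exp (-Complex.I * t * x) * (lam * charFun F t) = lam * G t := by
      intro t
      rw [hG]
      ring
    have hl : (lam : ℂ) ≠ 0 := by exact_mod_cast hlam
    have hp : (Real.pi : ℂ) ≠ 0 := by exact_mod_cast hpi.ne'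
    simp only [truncatedInversion, this]
    rw [intervalIntegral.integral_const_mul]
    field_simp
  have h2 : ∫ t, G t =
      (∫ t in Set.Iic (-T), G t) + (∫ t in (-T)..T, G t) + ∫ t in Set.Ioi T, G t := by
    rw [← intervalIntegral.integral_Iic_add_Ioi (b := T) hGi.integrableOn hGi.integrableOn,
      ← intervalIntegral.integral_Iic_sub_Iic (a := -T) hGi.integrableOn hGi.integrableOn]
    ring
  rw [density_eq_integral_charFun hf_meas hf_nonneg hF hφ hx, h1, ← hG, h2, ← mul_sub, norm_mul]
  have h3 : ‖(1 / (2 * Real.pi) : ℂ)‖ = 1 / (2 * Real.pi) := by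
    rw [show (1 / (2 * Real.pi) : ℂ) = ((1 / (2 * Real.pi) : ℝ) : ℂ) by push_cast; ring,
      Complex.norm_real, Real.norm_of_nonneg (by positivity)]
  have h4 : ‖∫ t in Set.Iic (-T), G t‖ ≤ ∫ t in Set.Ioi T, ‖charFun F t‖ := by
    rw [← integral_Iic_norm_charFun]
    simpa only [hGn] using norm_integral_le_integral_norm (μ := volume.restrict (Set.Iic (-T))) G
  have h5 : ‖∫ t in Set.Ioi T, G t‖ ≤ ∫ t in Set.Ioi T, ‖charFun F t‖ := by
    simpa only [hGn] using norm_integral_le_integral_norm (μ := volume.restrict (Set.Ioi T)) G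
  set J := ∫ t in Set.Ioi T, ‖charFun F t‖ with hJ
  have hJ0 : 0 ≤ J := integral_nonneg fun _ => norm_nonneg _
  have h6 : ‖(∫ t in (-T)..T, G t) -
      ((∫ t in Set.Iic (-T), G t) + (∫ t in (-T)..T, G t) + ∫ t in Set.Ioi T, G t)‖ ≤ 2 * J := by
    rw [show (∫ t in (-T)..T, G t) -
      ((∫ t in Set.Iic (-T), G t) + (∫ t in (-T)..T, G t) + ∫ t in Set.Ioi T, G t) =
      -((∫ t in Set.Iic (-T), G t) + ∫ t in Set.Ioi T, G t) by ring, norm_neg]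
    exact (norm_add_le _ _).trans (by linarith)
  rw [h3]
  calc _ ≤ 1 / (2 * Real.pi) * (2 * J) := by gcongr
    _ = J / Real.pi := by field_simp
    _ ≤ J := div_le_self hJ0 (by linarith [Real.pi_gt_three])

/-! ### Rates for the tail integral -/

/-- A tail bound near infinity against an antitone positive rate holds on all of `(0, ∞)`. -/
theorem exists_forall_integral_Ioi_norm_le {φ : ℝ → ℂ} (hφ : Integrable φ) {r : ℝ → ℝ}
    (hr0 : ∀ T, 0 < T → 0 < r T) (hr : AntitoneOn r (Set.Ioi 0)) {T₀ c : ℝ} (hT₀ : 0 < T₀)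
    (htail : ∀ T, T₀ ≤ T → ∫ t in Set.Ioi T, ‖φ t‖ ≤ c * r T) :
    ∃ K, 0 ≤ K ∧ ∀ T, 0 < T → ∫ t in Set.Ioi T, ‖φ t‖ ≤ K * r T := by
  have hI0 : 0 ≤ ∫ t, ‖φ t‖ := integral_nonneg fun _ => norm_nonneg _
  -- Below `T₀` the whole integral bounds the tail and `r` is at least `r T₀`. Small `T` must be
  -- covered because `β ≤ 0` is allowed, and then `1 / h` does not tend to infinity.
  refine ⟨max c ((∫ t, ‖φ t‖) / r T₀), le_max_of_le_right (div_nonneg hI0 (hr0 _ hT₀).le),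
    fun T hT => ?_⟩
  have hrT := hr0 T hT
  rcases le_total T₀ T with h | h
  · exact (htail T h).trans (by gcongr; exact le_max_left _ _)
  · have h1 : ∫ t in Set.Ioi T, ‖φ t‖ ≤ ∫ t, ‖φ t‖ :=
      setIntegral_le_integral hφ.norm (ae_of_all _ fun _ => norm_nonneg _)
    have h2 : r T₀ ≤ r T := hr hT hT₀ h
    calc _ ≤ ∫ t, ‖φ t‖ := h1
      _ = (∫ t, ‖φ t‖) / r T₀ * r T₀ := (div_mul_cancel₀ _ (hr0 _ hT₀).ne').symm
      _ ≤ (∫ t, ‖φ t‖) / r T₀ * r T := by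
          have := (hr0 _ hT₀).le
          gcongr
      _ ≤ _ := by
          gcongr
          exact le_max_right _ _

theorem exists_forall_norm_le_of_isBigO_cocompact {φ : ℝ → ℂ} {g : ℝ → ℝ}
    (h : φ =O[cocompact ℝ] g) :
    ∃ c T₀ : ℝ, 0 < c ∧ 0 < T₀ ∧ ∀ t, T₀ ≤ t → ‖φ t‖ ≤ c * ‖g t‖ := by
  rw [cocompact_eq_atBot_atTop, isBigO_sup] at h
  obtain ⟨c, hc, hb⟩ := h.2.exists_pos
  obtain ⟨T₀, hT₀⟩ := eventually_atTop.1 hb.bound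
  exact ⟨c, max T₀ 1, hc, lt_max_of_lt_right one_pos,
    fun t ht => hT₀ t ((le_max_left _ _).trans ht)⟩

theorem exists_integral_Ioi_norm_le_of_isBigO_rpow {φ : ℝ → ℂ} (hφ : Integrable φ) {γ : ℝ}
    (hγ : 1 < γ) (h : φ =O[cocompact ℝ] fun t : ℝ => |t| ^ (-γ)) :
    ∃ K, 0 ≤ K ∧ ∀ T, 0 < T → ∫ t in Set.Ioi T, ‖φ t‖ ≤ K * (1 / T) ^ (γ - 1) := by
  obtain ⟨c, T₀, hc, hT₀, hb⟩ := exists_forall_norm_le_of_isBigO_cocompact h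
  refine exists_forall_integral_Ioi_norm_le hφ (r := fun T => (1 / T) ^ (γ - 1))
    (fun T hT => by positivity) (fun T hT T' hT' hle => ?_) hT₀ (c := c / (γ - 1)) fun T hT => ?_
  · have : 0 < T := hT
    have hT'' : 0 < T' := hT'
    exact Real.rpow_le_rpow (by positivity) (one_div_le_one_div_of_le this hle) (by linarith)
  · have hT0 : 0 < T := hT₀.trans_le hT
    calc ∫ t in Set.Ioi T, ‖φ t‖ ≤ ∫ t in Set.Ioi T, c * t ^ (-γ) := by
          refine setIntegral_mono_on hφ.norm.integrableOn
            ((integrableOn_Ioi_rpow_of_lt (by linarith) hT0).const_mul c) measurableSet_Ioi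
            fun t ht => ?_
          have ht0 : 0 < t := hT0.trans ht
          refine (hb t (hT.trans ht.le)).trans_eq ?_
          rw [abs_of_pos ht0, Real.norm_of_nonneg (Real.rpow_nonneg ht0.le _)]
      _ = c / (γ - 1) * (1 / T) ^ (γ - 1) := by
          rw [integral_const_mul, integral_Ioi_rpow_of_lt (by linarith) hT0, one_div,
            Real.inv_rpow hT0.le, ← Real.rpow_neg hT0.le,
            show -(γ - 1) = -γ + 1 by ring, show -γ + 1 = -(γ - 1) by ring, neg_div_neg_eq]
          ring

theorem hasDerivAt_neg_exp_neg_rpow {α t : ℝ} (hα : α ≠ 0) (ht : 0 < t) :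
    HasDerivAt (fun t : ℝ => -(Real.exp (-t ^ α) / α)) (t ^ (α - 1) * Real.exp (-t ^ α)) t := by
  have h1 := ((Real.hasDerivAt_rpow_const (p := α) (Or.inl ht.ne')).neg.exp.div_const α).neg
  refine h1.congr_deriv ?_
  simp only [Pi.neg_apply]
  field_simp

/-- Beyond `T` one may insert `(t / T) ^ (α - 1) ≥ 1`, which turns the integrand into an exact
derivative. The inserted power of `1 / T` is the factor `h ^ (α - 1)` of the rate. -/
theorem exists_integral_Ioi_norm_le_of_isBigO_exp {φ : ℝ → ℂ} (hφ : Integrable φ) {α : ℝ}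
    (hα : 1 < α) (h : φ =O[cocompact ℝ] fun t : ℝ => Real.exp (-|t| ^ α)) :
    ∃ K, 0 ≤ K ∧ ∀ T, 0 < T →
      ∫ t in Set.Ioi T, ‖φ t‖ ≤ K * ((1 / T) ^ (α - 1) * Real.exp (-T ^ α)) := by
  obtain ⟨c, T₀, hc, hT₀, hb⟩ := exists_forall_norm_le_of_isBigO_cocompact h
  have hα0 : 0 < α := by linarith
  refine exists_forall_integral_Ioi_norm_le hφ
    (r := fun T => (1 / T) ^ (α - 1) * Real.exp (-T ^ α))
    (fun T hT => by positivity) (fun T hT T' hT' hle => ?_) hT₀ (c := c / α) fun T hT => ?_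
  · have h1 : 0 < T := hT
    have h2 : 0 < T' := hT'
    have h3 : (1 / T') ^ (α - 1) ≤ (1 / T) ^ (α - 1) :=
      Real.rpow_le_rpow (by positivity) (one_div_le_one_div_of_le h1 hle) (by linarith)
    have h4 : T ^ α ≤ T' ^ α := Real.rpow_le_rpow h1.le hle hα0.le
    show (1 / T') ^ (α - 1) * Real.exp (-T' ^ α) ≤ (1 / T) ^ (α - 1) * Real.exp (-T ^ α)
    gcongr
  · have hT0 : 0 < T := hT₀.trans_le hT
    have hlim : Tendsto (fun t : ℝ => -(Real.exp (-t ^ α) / α)) atTop (nhds 0) := by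
      have := ((Real.tendsto_exp_atBot.comp (tendsto_neg_atTop_atBot.comp
        (tendsto_rpow_atTop hα0))).div_const α).neg
      simpa using this
    have hder : ∀ t ∈ Set.Ici T, HasDerivAt (fun t : ℝ => -(Real.exp (-t ^ α) / α))
        (t ^ (α - 1) * Real.exp (-t ^ α)) t := fun t ht =>
      hasDerivAt_neg_exp_neg_rpow hα0.ne' (hT0.trans_le ht)
    have hnonneg : ∀ t ∈ Set.Ioi T, 0 ≤ t ^ (α - 1) * Real.exp (-t ^ α) := fun t ht => by
      have : 0 < t := hT0.trans ht
      positivity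
    have hint : IntegrableOn (fun t : ℝ => t ^ (α - 1) * Real.exp (-t ^ α)) (Set.Ioi T) :=
      integrableOn_Ioi_deriv_of_nonneg' hder hnonneg hlim
    have hval := integral_Ioi_of_hasDerivAt_of_tendsto' hder hint hlim
    calc ∫ t in Set.Ioi T, ‖φ t‖
        ≤ ∫ t in Set.Ioi T, c * (1 / T) ^ (α - 1) * (t ^ (α - 1) * Real.exp (-t ^ α)) := by
          refine setIntegral_mono_on hφ.norm.integrableOn (hint.const_mul _) measurableSet_Ioi
            fun t ht => ?_
          have ht0 : 0 < t := hT0.trans ht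
          have h5 : 1 ≤ (1 / T) ^ (α - 1) * t ^ (α - 1) := by
            rw [← Real.mul_rpow (by positivity) ht0.le]
            refine Real.one_le_rpow ?_ (by linarith)
            rw [one_div, inv_mul_eq_div, one_le_div hT0]
            exact ht.le
          refine (hb t (hT.trans ht.le)).trans ?_
          rw [abs_of_pos ht0, Real.norm_of_nonneg (Real.exp_pos _).le]
          calc c * Real.exp (-t ^ α) = c * (1 * Real.exp (-t ^ α)) := by ring
            _ ≤ c * (((1 / T) ^ (α - 1) * t ^ (α - 1)) * Real.exp (-t ^ α)) := by gcongr
            _ = _ := by ring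
      _ = c / α * ((1 / T) ^ (α - 1) * Real.exp (-T ^ α)) := by
          rw [integral_const_mul, hval]
          ring

/-! ### Bandwidth asymptotics and the choice of exponents -/

/-- `1 / h_n` is of smaller order than `(log n) ^ (1 / 2)`. -/
theorem isLittleO_one_div_bandwidth {h : ℕ → ℝ} {β : ℝ} (hβ : β < 1 / 2)
    (hh : h ~[atTop] fun n : ℕ => Real.log n ^ (-β)) :
    (fun n => 1 / h n) =o[atTop] fun n : ℕ => Real.log n ^ (1 / 2 : ℝ) := by
  have hlog : Tendsto (fun n : ℕ => Real.log n) atTop atTop :=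
    Real.tendsto_log_atTop.comp tendsto_natCast_atTop_atTop
  have h1 : (fun n => 1 / h n) =O[atTop] fun n : ℕ => (Real.log n ^ (-β))⁻¹ := by
    simp only [one_div]
    exact hh.inv.isBigO
  refine h1.trans_isLittleO (isLittleO_of_tendsto' ?_ ?_)
  · filter_upwards [hlog.eventually_gt_atTop 0] with n hn h0
    exact absurd h0 (Real.rpow_pos_of_pos hn _).ne'
  · have h2 := (tendsto_rpow_neg_atTop (y := 1 / 2 - β) (by linarith)).comp hlog
    refine h2.congr' ?_
    filter_upwards [hlog.eventually_gt_atTop 0] with n hn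
    simp only [Function.comp_apply]
    rw [← Real.rpow_neg hn.le, neg_neg, ← Real.rpow_sub hn]
    congr 1
    ring

theorem eventually_mul_one_div_bandwidth_le {h : ℕ → ℝ} (h_pos : ∀ n, 0 < h n) {β : ℝ}
    (hβ : β < 1 / 2) (hh : h ~[atTop] fun n : ℕ => Real.log n ^ (-β)) {c : ℝ} (hc : 0 < c) :
    ∀ᶠ n : ℕ in atTop, c * (1 / h n) ≤ Real.log n ∧ c * (1 / h n) ^ 2 ≤ Real.log n := by
  have hlog : Tendsto (fun n : ℕ => Real.log n) atTop atTop :=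
    Real.tendsto_log_atTop.comp tendsto_natCast_atTop_atTop
  -- With `s = (log n) ^ (1 / 2) ≥ 1`, the bound `(c + 1) T ≤ s` yields both `c T ≤ s²` and `c T² ≤
  -- s²`.
  have hd : 0 < 1 / (c + 1) := by positivity
  filter_upwards [(isLittleO_one_div_bandwidth hβ hh).bound hd, hlog.eventually_ge_atTop 1]
    with n hn hl
  have hT : 0 < 1 / h n := one_div_pos.2 (h_pos n)
  set T := 1 / h n with hTdef
  set s := Real.log n ^ (1 / 2 : ℝ) with hs
  have hs1 : 1 ≤ s := Real.one_le_rpow hl (by norm_num)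
  have hs2 : s * s = Real.log n := by
    rw [hs, ← Real.rpow_add (by linarith)]
    norm_num
  rw [Real.norm_of_nonneg hT.le, Real.norm_of_nonneg (by linarith), one_div, inv_mul_eq_div,
    le_div_iff₀ (by positivity)] at hn
  rw [← hs2]
  constructor <;> nlinarith [mul_pos hc hT, mul_pos hT hT, mul_pos (mul_pos hc hT) hT]

/-- Here `l = log n`: a deviation `n^{-1/8}`, amplified by `T e^{T²/2}`, remains `O(n^{-1/16})`
because `T` and `T²` are at most `l / 100`. -/
theorem mul_relError_le {lam T l : ℝ} (hlam : 0 < lam) (hT : 0 ≤ T)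
    (h1 : 100 * T ≤ l) (h2 : 100 * T ^ 2 ≤ l) :
    T / (Real.pi * lam) * (3 / 2 * (Real.exp (-l / 8) * Real.exp (2 * lam + T ^ 2 / 2))) ≤
      3 / 2 * Real.exp (2 * lam) / (Real.pi * lam) * Real.exp (-l / 16) := by
  have hpi := Real.pi_pos
  have hTe : T ≤ Real.exp T := by linarith [Real.add_one_le_exp T]
  have h3 : T * (Real.exp (-l / 8) * Real.exp (2 * lam + T ^ 2 / 2)) ≤
      Real.exp (2 * lam) * Real.exp (-l / 16) := by
    calc _ ≤ Real.exp T * (Real.exp (-l / 8) * Real.exp (2 * lam + T ^ 2 / 2)) := by gcongr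
      _ = Real.exp (T + (-l / 8 + (2 * lam + T ^ 2 / 2))) := by
          rw [← Real.exp_add, ← Real.exp_add]
      _ ≤ Real.exp (2 * lam + -l / 16) := Real.exp_le_exp.2 (by linarith)
      _ = _ := Real.exp_add _ _
  calc _ = 3 / 2 / (Real.pi * lam) *
        (T * (Real.exp (-l / 8) * Real.exp (2 * lam + T ^ 2 / 2))) := by ring
    _ ≤ 3 / 2 / (Real.pi * lam) * (Real.exp (2 * lam) * Real.exp (-l / 16)) := by gcongr
    _ = _ := by ring

theorem relError_le_half {lam T l : ℝ} (hT2 : 100 * T ^ 2 ≤ l) (hl : 16 * (2 * lam + 1) ≤ l) :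
    Real.exp (-l / 8) * Real.exp (2 * lam + T ^ 2 / 2) ≤ 1 / 2 := by
  rw [← Real.exp_add]
  have h1 : (2 : ℝ) ≤ Real.exp 1 := by linarith [Real.add_one_le_exp 1]
  calc Real.exp (-l / 8 + (2 * lam + T ^ 2 / 2)) ≤ Real.exp (-1) :=
        Real.exp_le_exp.2 (by nlinarith [sq_nonneg T])
    _ = 1 / Real.exp 1 := by rw [Real.exp_neg, one_div]
    _ ≤ 1 / 2 := one_div_le_one_div_of_le (by norm_num) h1

/-- This is `2 M_n` times the bad probability for Lipschitz threshold `n^{1/4}` and deviation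
`n^{-1/8}`. Both terms of the probability are `O(n^{-1/4})`, and the logarithm is absorbed by `16
n^{1/16}`. -/
theorem log_mul_badProbability_le {C T l m : ℝ} (hC : 0 < C) (hT : 0 ≤ T) (hm : 0 ≤ m)
    (h1 : 100 * T ≤ l) :
    2 * (C * l) * (m / Real.exp (l / 4) +
        16 * (T + 1) * (Real.exp (l / 4) + m) / (Real.exp l * Real.exp (-l / 8) ^ 3)) ≤
      32 * C * (m + 16 * (1 + m)) * Real.exp (-l / 16) := by
  have hl : 0 ≤ l := by linarith
  have hTe : T + 1 ≤ Real.exp T := Real.add_one_le_exp T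
  have hle : l ≤ 16 * Real.exp (l / 16) := by linarith [Real.add_one_le_exp (l / 16)]
  have he1 : 1 ≤ Real.exp (l / 4) := Real.one_le_exp (by positivity)
  have hden : Real.exp l * Real.exp (-l / 8) ^ 3 = Real.exp (5 * l / 8) := by
    rw [← Real.exp_nat_mul, ← Real.exp_add]
    congr 1
    push_cast
    ring
  have hfirst : m / Real.exp (l / 4) = m * Real.exp (-l / 4) := by
    rw [div_eq_mul_inv, ← Real.exp_neg]
    ring_nf
  have hsecond : 16 * (T + 1) * (Real.exp (l / 4) + m) / Real.exp (5 * l / 8) ≤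
      16 * (1 + m) * Real.exp (-l / 4) := by
    rw [div_le_iff₀ (Real.exp_pos _)]
    calc 16 * (T + 1) * (Real.exp (l / 4) + m)
        ≤ 16 * Real.exp T * (Real.exp (l / 4) + m * Real.exp (l / 4)) := by
          gcongr
          exact le_mul_of_one_le_right hm he1
      _ = 16 * (1 + m) * Real.exp (T + l / 4) := by rw [Real.exp_add]; ring
      _ ≤ 16 * (1 + m) * Real.exp (-l / 4 + 5 * l / 8) := by
          refine mul_le_mul_of_nonneg_left (Real.exp_le_exp.2 ?_) (by positivity)
          linarith
      _ = _ := by rw [Real.exp_add]; ring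
  rw [hden, hfirst]
  calc _ ≤ 2 * (C * (16 * Real.exp (l / 16))) *
        (m * Real.exp (-l / 4) + 16 * (1 + m) * Real.exp (-l / 4)) := by gcongr
    _ = 32 * C * (m + 16 * (1 + m)) * Real.exp (l / 16 + -l / 4) := by rw [Real.exp_add]; ring
    _ ≤ _ := by
        gcongr
        linarith

/-! ### Assembly of the bias bound -/

/-- The bias of the truncated estimator is bounded by any rate that dominates both the tail
integral of the jump characteristic function and `n ^ (-1 / 16)`. -/
theorem isBigO_integral_fHat_sub {Ω : Type*} [MeasurableSpace Ω] {P : Measure Ω}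
    [IsProbabilityMeasure P] {lam : ℝ≥0} (hlam : 0 < lam)
    {F : Measure ℝ} [IsProbabilityMeasure F] {f : ℝ → ℝ} (hf_meas : Measurable f)
    (hf_nonneg : ∀ y, 0 ≤ f y) (hF : F = volume.withDensity fun y => ENNReal.ofReal (f y))
    (hF1 : Integrable (fun y : ℝ => y) F) {X : ℕ → Ω → ℝ}
    (hXm : ∀ n : ℕ, AEMeasurable (fun ω (j : Fin n) => X j ω) P)
    (hX : ∀ n : ℕ, P.map (fun ω (j : Fin n) => X j ω) =
      Measure.pi fun _ => noisyCompoundPoisson lam F)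
    (hφ : Integrable (charFun F)) {h : ℕ → ℝ} (h_pos : ∀ n, 0 < h n) {β : ℝ} (hβ : β < 1 / 2)
    (hh : h ~[atTop] fun n : ℕ => Real.log n ^ (-β)) {M : ℕ → ℝ} {C : ℝ} (hC : 0 < C)
    (hM : ∀ n : ℕ, M n = C * Real.log n) {x : ℝ} (hx : ContinuousAt f x)
    {r : ℝ → ℝ} {K c : ℝ} (hr : ∀ T, 0 < T → ∫ t in Set.Ioi T, ‖charFun F t‖ ≤ K * r T)
    (hlow : ∀ᶠ n : ℕ in atTop, Real.exp (-Real.log n / 16) ≤ c * r (1 / h n)) :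
    (fun n : ℕ => (∫ ω, fHat lam (h n) (M n) (fun j : Fin n => X j ω) x ∂P) - f x)
      =O[atTop] fun n : ℕ => r (1 / h n) := by
  have hlam' : (0 : ℝ) < lam := hlam
  have hlog : Tendsto (fun n : ℕ => Real.log n) atTop atTop :=
    Real.tendsto_log_atTop.comp tendsto_natCast_atTop_atTop
  set μ := noisyCompoundPoisson lam F with hμ
  have hμ1 : Integrable (fun y : ℝ => y) μ := integrable_id_noisyCompoundPoisson lam F hF1
  set m := ∫ y, |y| ∂μ with hm
  have hm0 : 0 ≤ m := integral_nonneg fun _ => abs_nonneg _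
  set A := 3 / 2 * Real.exp (2 * lam) / (Real.pi * lam) + 32 * C * (m + 16 * (1 + m)) with hA
  have hA0 : 0 ≤ A := by
    have := Real.pi_pos
    positivity
  refine IsBigO.of_bound |A * c + K| ?_
  -- The last two lower bounds on `log n` make the relative error at most `1 / 2` and put the
  -- centering `D` inside the truncation interval.
  filter_upwards [hlow, eventually_mul_one_div_bandwidth_le h_pos hβ hh (c := 100) (by norm_num),
    eventually_ne_atTop 0, hlog.eventually_ge_atTop (16 * (2 * lam + 1)),
    hlog.eventually_ge_atTop ((|f x| + ∫ t, ‖charFun F t‖) / C)] with n hn1 hn2 hn0 hl1 hl2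
  have hT : 0 < 1 / h n := one_div_pos.2 (h_pos n)
  set T := 1 / h n with hTdef
  set l := Real.log n with hl
  have hnl : (n : ℝ) = Real.exp l :=
    (Real.exp_log (by exact_mod_cast Nat.pos_of_ne_zero hn0)).symm
  set D := (truncatedInversion lam T (fun t => (lam : ℝ) * charFun F t) x).re with hD
  have hDf : |D - f x| ≤ ∫ t in Set.Ioi T, ‖charFun F t‖ := by
    have h1 := norm_truncatedInversion_sub_density_le hf_meas hf_nonneg hF hφ hx (T := T) hlam'.ne'
    have h2 := Complex.abs_re_le_norm
      (truncatedInversion lam T (fun t => (lam : ℝ) * charFun F t) x - f x)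
    rw [Complex.sub_re, Complex.ofReal_re] at h2
    exact h2.trans h1
  have hDM : |D| ≤ M n := by
    have h1 : ∫ t in Set.Ioi T, ‖charFun F t‖ ≤ ∫ t, ‖charFun F t‖ :=
      setIntegral_le_integral hφ.norm (ae_of_all _ fun _ => norm_nonneg _)
    have h2 := abs_add_le (D - f x) (f x)
    rw [sub_add_cancel] at h2
    rw [div_le_iff₀ hC, mul_comm] at hl2
    rw [hM]
    linarith
  obtain ⟨B, hBm, hBp, hBg⟩ := exists_measurableSet_norm_empCharFun_sub_le μ hμ1 hn0 hT.le
    (Real.exp_pos (-l / 8)) (Real.exp_pos (l / 4)) (by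
      have : Real.exp (-l / 8) ≤ Real.exp (l / 4) := Real.exp_le_exp.2 (by linarith [hn2.1])
      linarith [Real.exp_pos (l / 4)])
  have hEx : |(∫ xs, fHat lam (h n) (M n) xs x ∂(Measure.pi fun _ : Fin n => μ)) - D| ≤
      A * Real.exp (-l / 16) := by
    refine (abs_integral_fHat_sub_le hlam' (h_pos n) hDM _ hBm (by positivity)
      fun xs hxs => abs_fnh_sub_re_truncatedInversion_le hlam F (h_pos n) hn0 (hBg xs hxs)
        (relError_le_half hn2.2 hl1) x).trans ?_
    rw [hA, add_mul, hM]
    refine add_le_add (mul_relError_le hlam' hT.le hn2.1 hn2.2) ?_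
    have hl0 : 0 ≤ l := by linarith [hn2.1]
    refine le_trans ?_ (log_mul_badProbability_le hC hT.le hm0 hn2.1)
    rw [hnl] at hBp
    gcongr
  have hint : ∫ ω, fHat lam (h n) (M n) (fun j : Fin n => X j ω) x ∂P =
      ∫ xs, fHat lam (h n) (M n) xs x ∂(Measure.pi fun _ : Fin n => μ) := by
    rw [← hX n, integral_map (hXm n)
      (measurable_fHat hlam' (h_pos n) _ n x).aestronglyMeasurable]
  rw [hint, Real.norm_eq_abs, Real.norm_eq_abs]
  calc _ ≤ |(∫ xs, fHat lam (h n) (M n) xs x ∂(Measure.pi fun _ : Fin n => μ)) - D| +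
        |D - f x| := abs_sub_le _ _ _
    _ ≤ A * Real.exp (-l / 16) + K * r T := add_le_add hEx (hDf.trans (hr T hT))
    _ ≤ A * (c * r T) + K * r T := by gcongr
    _ = (A * c + K) * r T := by ring
    _ ≤ |(A * c + K) * r T| := le_abs_self _
    _ = |A * c + K| * |r T| := abs_mul _ _

theorem rpow_le_exp_mul {T p : ℝ} (hT : 0 ≤ T) (hp : 0 ≤ p) : T ^ p ≤ Real.exp (p * T) := by
  have h1 : T ≤ Real.exp T := by linarith [Real.add_one_le_exp T]
  calc T ^ p ≤ Real.exp T ^ p := Real.rpow_le_rpow hT h1 hp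
    _ = Real.exp (p * T) := by rw [← Real.exp_mul, mul_comm]

/-- As `T = o(log n)`, this shows that polynomial rates in `h` dominate `n^{-1/16}`. -/
theorem exp_neg_mul_le_one_div_rpow {T p : ℝ} (hT : 0 < T) (hp : 0 ≤ p) :
    Real.exp (-(p * T)) ≤ (1 / T) ^ p := by
  rw [one_div, Real.inv_rpow hT.le, Real.exp_neg]
  exact inv_anti₀ (Real.rpow_pos_of_pos hT p) (rpow_le_exp_mul hT.le hp)

theorem rpow_le_one_add_sq {T α : ℝ} (hT : 0 ≤ T) (hα0 : 0 ≤ α) (hα : α ≤ 2) :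
    T ^ α ≤ 1 + T ^ 2 := by
  rcases le_total T 1 with h | h
  · linarith [Real.rpow_le_one hT h hα0, sq_nonneg T]
  · have := Real.rpow_le_rpow_of_exponent_le h hα
    rw [Real.rpow_two] at this
    linarith

end Decompounding

theorem mainTheorem3 {Ω : Type*} [MeasurableSpace Ω] (P : Measure Ω) [IsProbabilityMeasure P]
    -- the known intensity
    (lam : ℝ≥0) (hlam : 0 < lam)
    -- the jump size distribution `F` with density `f`
    (F : Measure ℝ) [IsProbabilityMeasure F] (f : ℝ → ℝ) (hf_meas : Measurable f)
    (hf_nonneg : ∀ y, 0 ≤ f y) (hF : F = volume.withDensity fun y => ENNReal.ofReal (f y))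
    -- the i.i.d. observations `X_i = Y_i + Z_i`
    (X Y Z : ℕ → Ω → ℝ)
    (hY : ∀ i, HasLaw (Y i) (Decompounding.compoundPoisson lam F) P)
    (hZ : ∀ i, HasLaw (Z i) (gaussianReal 0 1) P)
    (hYZ : ∀ i, IndepFun (Y i) (Z i) P)
    (hXYZ : ∀ i ω, X i ω = Y i ω + Z i ω)
    (hX : iIndepFun X P)
    -- the characteristic function of `f` is integrable
    (hφ : Integrable (charFun F))
    -- the bandwidth
    (h : ℕ → ℝ) (h_pos : ∀ n, 0 < h n) (β : ℝ) (hβ : β < 1 / 2)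
    (hh : h ~[atTop] fun n : ℕ => Real.log n ^ (-β))
    -- the truncating sequence
    (M : ℕ → ℝ) (C : ℝ) (hC : 0 < C) (hM : ∀ n : ℕ, M n = C * Real.log n)
    -- the moment condition
    (ρ : ℝ) (hρ : 1 < ρ) (hmom : Integrable fun y : ℝ => |y| ^ ρ * f y)
    -- the point of estimation, where `f` agrees with its continuous version
    (x : ℝ) (hx : ContinuousAt f x) :
    (∀ n, Integrable (fun ω => Decompounding.fHat lam (h n) (M n) (fun j : Fin n => X j ω) x) P) ∧
    (∀ α : ℝ, 1 < α → α ≤ 2 →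
      charFun F =O[cocompact ℝ] (fun t : ℝ => Real.exp (-|t| ^ α)) →
      (fun n : ℕ =>
          (∫ ω, Decompounding.fHat lam (h n) (M n) (fun j : Fin n => X j ω) x ∂P) - f x)
        =O[atTop] fun n : ℕ => h n ^ (α - 1) * Real.exp (-(1 / h n ^ α))) ∧
    (∀ γ : ℝ, 1 < γ →
      charFun F =O[cocompact ℝ] (fun t : ℝ => |t| ^ (-γ)) →
      (fun n : ℕ =>
          (∫ ω, Decompounding.fHat lam (h n) (M n) (fun j : Fin n => X j ω) x ∂P) - f x)
        =O[atTop] fun n : ℕ => h n ^ (γ - 1)) := by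
  have hlam' : (0 : ℝ) < lam := hlam
  have hF1 := Decompounding.integrable_id_of_integrable_rpow hf_meas hf_nonneg hF hρ.le hmom
  have hsample := Decompounding.map_sample_eq_pi hY hZ hYZ hXYZ hX
  have hM0 : ∀ n, 0 ≤ M n := fun n => by
    rw [hM]
    exact mul_nonneg hC.le (Real.log_natCast_nonneg n)
  refine ⟨fun n => ?_, fun α hα1 hα2 hα => ?_, fun γ hγ1 hγ => ?_⟩
  · refine Integrable.of_bound (C := M n) ?_
      (ae_of_all _ fun ω => Decompounding.abs_fHat_le (hM0 n) _ x)
    exact ((Decompounding.measurable_fHat hlam' (h_pos n) (M n) n x).comp_aemeasurable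
      (hsample n).1).aestronglyMeasurable
  · obtain ⟨K, -, hK⟩ := Decompounding.exists_integral_Ioi_norm_le_of_isBigO_exp hφ hα1 hα
    have key := Decompounding.isBigO_integral_fHat_sub hlam hf_meas hf_nonneg hF hF1
      (fun n => (hsample n).1) (fun n => (hsample n).2) hφ h_pos hβ hh hC hM hx
      (r := fun T => (1 / T) ^ (α - 1) * Real.exp (-T ^ α)) (c := Real.exp 1) hK ?_
    · refine key.congr_right fun n => ?_
      simp only [one_div_one_div]
      rw [Real.div_rpow zero_le_one (h_pos n).le, Real.one_rpow]
    -- With `c = 32`, both `(α - 1) T ≤ T` and `T²` are at most `log n / 32`, so together they use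
    -- up the exponent `1 / 16`. The constant `e` absorbs the `1` in `T ^ α ≤ 1 + T²`.
    · filter_upwards [Decompounding.eventually_mul_one_div_bandwidth_le h_pos hβ hh (c := 32)
        (by norm_num)] with n hn
      have hT : 0 < 1 / h n := one_div_pos.2 (h_pos n)
      set T := 1 / h n with hTdef
      have h1 := Decompounding.exp_neg_mul_le_one_div_rpow hT (p := α - 1) (by linarith)
      have h2 := Decompounding.rpow_le_one_add_sq hT.le (α := α) (by linarith) hα2
      calc Real.exp (-Real.log n / 16)
          ≤ Real.exp (1 + (-((α - 1) * T) + -(1 + T ^ 2))) :=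
            Real.exp_le_exp.2 (by nlinarith [hn.1, hn.2])
        _ = Real.exp 1 * (Real.exp (-((α - 1) * T)) * Real.exp (-(1 + T ^ 2))) := by
            rw [Real.exp_add, Real.exp_add]
        _ ≤ Real.exp 1 * ((1 / T) ^ (α - 1) * Real.exp (-T ^ α)) := by gcongr
  · obtain ⟨K, -, hK⟩ := Decompounding.exists_integral_Ioi_norm_le_of_isBigO_rpow hφ hγ1 hγ
    have key := Decompounding.isBigO_integral_fHat_sub hlam hf_meas hf_nonneg hF hF1
      (fun n => (hsample n).1) (fun n => (hsample n).2) hφ h_pos hβ hh hC hM hx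
      (r := fun T => (1 / T) ^ (γ - 1)) (c := 1) hK ?_
    · refine key.congr_right fun n => ?_
      simp only [one_div_one_div]
    · filter_upwards [Decompounding.eventually_mul_one_div_bandwidth_le h_pos hβ hh
        (c := 16 * (γ - 1)) (by linarith)] with n hn
      have hT : 0 < 1 / h n := one_div_pos.2 (h_pos n)
      rw [one_mul]
      refine le_trans (Real.exp_le_exp.2 ?_)
        (Decompounding.exp_neg_mul_le_one_div_rpow hT (p := γ - 1) (by linarith))
      linarith [hn.1]
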